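/- Variables are the natural numbers. A literal is a variable or its negation, a clause is a finite set of literals (read as their disjunction), and a CNF formula is a finite set of clauses (read as their conjunction). A clause is a tautology if it contains a variable and its negation. A formula is Horn if each of its clauses contains at most one positive literal. $\mathrm{Var}(A)$ is the set of variables occurring in $A$. The size $\|A\|$ of $A$ is its number of literal occurrences, that is, the sum of the cardinalities of its clauses; $A$ is minimal if $\|A\| \le \|B\|$ for every CNF formula $B$ equivalent to $A$. For a set $Y$ of variables, a CNF formula $B$ expresses forgetting all variables from $A$ but $Y$ if $\mathrm{Var}(B) \subseteq Y$ and, for every CNF formula $C$ with $\mathrm{Var}(C) \subseteq Y$, $B \models C$ if and only if $A \models C$. There is a polynomial-time algorithm (a Turing machine whose number of steps is bounded by a polynomial in the length of its input, formulae being written as strings with variable names in binary, and the number $k$ below being written in unary) that turns every CNF formula $F$ into a CNF formula $A$, a set of variables $X_C \subseteq \mathrm{Var}(A)$ and a number $k \in \mathbb{N}$ such that $A$ is Horn, contains no tautology and is minimal, and: 1. if $F$ is satisfiable, then forgetting all variables from $A$ but $X_C$ is expressed by a Horn formula without tautologies of size exactly $k$, and by no CNF formula of size less than $k$; 2. if $F$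 is unsatisfiable, then every CNF formula that expresses forgetting all variables from $A$ but $X_C$ has size greater than $k$. -/

import Mathlib

namespace HornForget

/-! ### Propositional formulae in conjunctive normal form -/

/-- A literal over the variables `ℕ`: `(x, true)` is `x` and `(x, false)` is `¬ x`. -/
abbrev Literal := ℕ × Bool

/-- A clause, the disjunction of a finite set of literals. -/
abbrev Clause := Finset Literal

/-- A CNF formula, the conjunction of a finite set of clauses. -/
abbrev CNF := Finset Clause

/-- The variables occurring in a formula. -/
def vars (A : CNF) : Finset ℕ := A.biUnion fun c => c.image Prod.fst

/-- The size of a formula: its number of literal occurrences. -/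
def size (A : CNF) : ℕ := ∑ c ∈ A, c.card

/-- `v` satisfies every clause of `A`. -/
def Models (v : ℕ → Bool) (A : CNF) : Prop := ∀ c ∈ A, ∃ l ∈ c, v l.1 = l.2

def Satisfiable (A : CNF) : Prop := ∃ v, Models v A

def Entails (A C : CNF) : Prop := ∀ v, Models v A → Models v C

def Equivalent (A B : CNF) : Prop := ∀ v, Models v A ↔ Models v B

/-- No clause contains a variable together with its negation. -/
def TautologyFree (A : CNF) : Prop := ∀ c ∈ A, ∀ x, ¬((x, true) ∈ c ∧ (x, false) ∈ c)

/-- Every clause contains at most one positive literal. -/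
def IsHorn (A : CNF) : Prop := ∀ c ∈ A, (c.filter fun l => l.2 = true).card ≤ 1

/-- No CNF formula equivalent to `A` is smaller than `A`. -/
def IsMinimal (A : CNF) : Prop := ∀ B, Equivalent A B → size A ≤ size B

/-- `B` expresses forgetting all variables from `A` but `Y`. -/
def ExpressesForgetting (A : CNF) (Y : Finset ℕ) (B : CNF) : Prop :=
  vars B ⊆ Y ∧ ∀ C, vars C ⊆ Y → (Entails B C ↔ Entails A C)

/-! ### Formulae as strings, for use as input and output of Turing machines -/

/-- A formula as it is written: a list of lists of literals. -/
abbrev WrittenCNF := List (List Literal)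

/-- The formula that is written; order and repetitions are immaterial. -/
def WrittenCNF.toCNF (F : WrittenCNF) : CNF := (F.map List.toFinset).toFinset

/-- The finite alphabet: bits, a mark for the beginning of a literal (with its sign), marks for
the beginning of a clause and of a variable in a list of variables, and the unary digit. -/
inductive Sym
  | bit (b : Bool)
  | lit (pos : Bool)
  | clause
  | var
  | tick
  deriving DecidableEq, Fintype

/-- The name of a variable, in binary. -/
def encodeName (x : ℕ) : List Sym := (Computability.encodeNat x).map Sym.bit

def encodeLiteral (l : Literal) : List Sym := Sym.lit l.2 :: encodeName l.1

def encodeClause (c : List Literal) : List Sym := Sym.clause :: c.flatMap encodeLiteral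

def encodeCNF (F : WrittenCNF) : List Sym := F.flatMap encodeClause

def encodeVars (X : List ℕ) : List Sym := X.flatMap fun x => Sym.var :: encodeName x

/-- A formula, a list of variables and a number; the number is in unary. -/
def encodeInstance (p : WrittenCNF × List ℕ × ℕ) : List Sym :=
  encodeCNF p.1 ++ encodeVars p.2.1 ++ List.replicate p.2.2 Sym.tick

/-- The state of the decoder, which reads a string from right to left. -/
structure DecodeState where
  bits : List Bool
  lits : List Literal
  clauses : WrittenCNF
  names : List ℕ
  count : ℕ

def decodeStep : Sym → DecodeState → DecodeState
  | .bit b, s => { s with bits := b :: s.bits }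
  | .lit p, s => { s with bits := [], lits := (Computability.decodeNat s.bits, p) :: s.lits }
  | .clause, s => { s with lits := [], clauses := s.lits :: s.clauses }
  | .var, s => { s with bits := [], names := Computability.decodeNat s.bits :: s.names }
  | .tick, s => { s with count := s.count + 1 }

def decodeSyms (w : List Sym) : DecodeState := w.foldr decodeStep ⟨[], [], [], [], 0⟩

theorem foldr_bits (L : List Bool) (cs : List Literal) (F : WrittenCNF) (X : List ℕ) (k : ℕ) :
    (L.map Sym.bit).foldr decodeStep ⟨[], cs, F, X, k⟩ = ⟨L, cs, F, X, k⟩ := by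
  induction L with
  | nil => rfl
  | cons b L ih => simp [ih, decodeStep]

theorem foldr_lits (c : List Literal) (F : WrittenCNF) (X : List ℕ) (k : ℕ) :
    (c.flatMap encodeLiteral).foldr decodeStep ⟨[], [], F, X, k⟩ = ⟨[], c, F, X, k⟩ := by
  induction c with
  | nil => rfl
  | cons l c ih => simp [ih, encodeLiteral, encodeName, foldr_bits, decodeStep]

theorem foldr_cnf (F : WrittenCNF) (X : List ℕ) (k : ℕ) :
    (encodeCNF F).foldr decodeStep ⟨[], [], [], X, k⟩ = ⟨[], [], F, X, k⟩ := by
  induction F with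
  | nil => rfl
  | cons c F ih =>
    have h : encodeCNF (c :: F) = encodeClause c ++ encodeCNF F := rfl
    simp [h, ih, encodeClause, foldr_lits, decodeStep]

theorem foldr_vars (X : List ℕ) (k : ℕ) :
    (encodeVars X).foldr decodeStep ⟨[], [], [], [], k⟩ = ⟨[], [], [], X, k⟩ := by
  induction X with
  | nil => rfl
  | cons x X ih =>
    have h : encodeVars (x :: X) = (Sym.var :: encodeName x) ++ encodeVars X := rfl
    simp [h, ih, encodeName, foldr_bits, decodeStep]

theorem foldr_ticks (k : ℕ) :
    (List.replicate k Sym.tick).foldr decodeStep ⟨[], [], [], [], 0⟩ = ⟨[], [], [], [], k⟩ := by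
  induction k with
  | zero => rfl
  | succ k ih => simp [List.replicate_succ, ih, decodeStep]

/-- The encoding of formulae as strings. -/
def cnfEncoding : Computability.Encoding WrittenCNF Sym where
  encode := encodeCNF
  decode w := some (decodeSyms w).clauses
  decode_encode F := by simp [decodeSyms, foldr_cnf]

/-- The encoding of triples (formula, list of variables, number) as strings. -/
def instanceEncoding : Computability.Encoding (WrittenCNF × List ℕ × ℕ) Sym where
  encode := encodeInstance
  decode w := some ((decodeSyms w).clauses, (decodeSyms w).names, (decodeSyms w).count)
  decode_encode p := by
    simp [decodeSyms, encodeInstance, foldr_cnf, foldr_vars, foldr_ticks]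

/-- `f` is computed by a Turing machine within a number of steps that is polynomial in the length
of the input string. -/
def PolyTime (f : WrittenCNF → WrittenCNF × List ℕ × ℕ) : Prop :=
  Nonempty (Turing.TM2ComputableInPolyTime cnfEncoding.encode instanceEncoding.encode f)

end HornForget

/-! The hard question is how cheaply one variable, `start`, can be made to imply both literals of
every variable of `F`. In `A`, `start` implies `aux b x`, which implies `lit b x`, and it reaches
`goal` through `goalAux`. The detour makes all these implications irredundant, so `A` is minimal.
After forgetting `aux` and `goalAux`, only consequences such as `start → lit b x` and `start → goal`
remain, and these can be derived from each other through the clauses that are kept: a literal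
implies the clauses `cl j` it occurs in, all the `cl j` imply `goal`, and `goal` turns each literal
into its opposite.

If `β` satisfies `F`, the clauses `start → lit (β x) x` are enough: they yield every `cl j`, hence
`goal`, hence the other literals (`lit_of_start`, `expressesForgetting`). Conversely, any formula
that expresses forgetting needs, besides the kept clauses, one clause of at least two literals per
variable (`exists_choice_clause`). If it has no more than that, it is the kept clauses plus a choice
of one literal per variable, and it can entail `start → goal` only if this choice satisfies `F`
(`size_bound`).

Both minimality and the lower bound rest on essential clauses. If an assignment falsifies `c`, and
each change that makes one literal of `c` true gives a model of `A`, then every consequence of `A`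
that is false at that assignment contains all of `c`. A formula between `A` and a set of essential
clauses thus has distinct clauses above them (`exists_injOn_superset`).

For polynomial time, a small language of stack programs with step counts is compiled to `TM2`
machines (`Exec.iterate_step`, `nonempty_polyTime`). The program for the reduction scans the
remaining input at each literal, since repeated literals and variables must be counted only once;
this gives a cubic bound. -/

namespace HornForget

/-! ### Structured programs over finitely many stacks -/

/-- Structured programs over stacks indexed by `K` with symbols in `Γ` and a register in `R`.
Tests may look at the register and at the top of one stack. -/
inductive Prog (K Γ R : Type)
  | load (f : R → R)
  | push (k : K) (f : R → Γ)
  | pop (k : K) (f : R → Option Γ → R)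
  | transfer (k : K) (ds : List K)
  | seq (p q : Prog K Γ R)
  | ite (k : K) (b : R → Option Γ → Bool) (p q : Prog K Γ R)
  | loop (k : K) (b : R → Option Γ → Bool) (p : Prog K Γ R)

namespace Prog

open Function Turing

variable {K Γ R : Type} [DecidableEq K]

/-- Push `a` on all the stacks of a list. -/
def pushAll (a : Γ) : List K → (K → List Γ) → K → List Γ
  | [], S => S
  | d :: ds, S => pushAll a ds (update S d (a :: S d))

/-- The contents of the register and of the stacks. -/
abbrev Mem (K Γ R : Type) := R × (K → List Γ)

/-- `Exec p c t c'`: from memory `c`, program `p` ends with memory `c'` after `t` steps. -/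
inductive Exec : Prog K Γ R → Mem K Γ R → ℕ → Mem K Γ R → Prop
  | load (f r S) : Exec (.load f) (r, S) 1 (f r, S)
  | push (k f r S) : Exec (.push k f) (r, S) 1 (r, update S k (f r :: S k))
  | pop (k f r S) : Exec (.pop k f) (r, S) 1 (f r (S k).head?, update S k (S k).tail)
  | transfer (k ds r S a L) (h : S k = a :: L) :
      Exec (.transfer k ds) (r, S) 1 (r, pushAll a ds (update S k L))
  | seq {p q c₁ t₁ c₂ t₂ c₃} (h₁ : Exec p c₁ t₁ c₂) (h₂ : Exec q c₂ t₂ c₃) :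
      Exec (.seq p q) c₁ (t₁ + t₂) c₃
  | ite_true {k b p q c t c'} (hb : b c.1 (c.2 k).head? = true) (h : Exec p c t c') :
      Exec (.ite k b p q) c (t + 1) c'
  | ite_false {k b p q c t c'} (hb : b c.1 (c.2 k).head? = false) (h : Exec q c t c') :
      Exec (.ite k b p q) c (t + 1) c'
  | loop_true {k b p c₁ t₁ c₂ t₂ c₃} (hb : b c₁.1 (c₁.2 k).head? = true)
      (h₁ : Exec p c₁ t₁ c₂) (h₂ : Exec (.loop k b p) c₂ t₂ c₃) :
      Exec (.loop k b p) c₁ (t₁ + t₂ + 1) c₃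
  | loop_false {k b p c} (hb : b c.1 (c.2 k).head? = false) : Exec (.loop k b p) c 1 c

/-- `Runs p c c' n`: from memory `c`, program `p` ends with memory `c'` after at most `n` steps. -/
def Runs (p : Prog K Γ R) (c c' : Mem K Γ R) (n : ℕ) : Prop := ∃ t ≤ n, Exec p c t c'

namespace Runs

variable {p q : Prog K Γ R} {c c₁ c₂ c₃ : Mem K Γ R} {n n₁ n₂ : ℕ} {k : K}
  {b : R → Option Γ → Bool}

theorem mono (h : Runs p c₁ c₂ n₁) (hn : n₁ ≤ n) : Runs p c₁ c₂ n :=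
  let ⟨t, ht, e⟩ := h
  ⟨t, ht.trans hn, e⟩

theorem of_eq (h : Runs p c₁ c₂ n₁) (hc : c₂ = c₃) (hn : n₁ ≤ n) : Runs p c₁ c₃ n :=
  hc ▸ h.mono hn

theorem cast (h : Runs p c₁ c₂ n₁) {c₀ : Mem K Γ R} (h₀ : c₀ = c₁) (hc : c₂ = c₃)
    (hn : n₁ ≤ n) : Runs p c₀ c₃ n :=
  h₀ ▸ h.of_eq hc hn

theorem load (f : R → R) (r : R) (S : K → List Γ) : Runs (.load f) (r, S) (f r, S) 1 :=
  ⟨1, le_rfl, .load ..⟩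

theorem push (k : K) (f : R → Γ) (r : R) (S : K → List Γ) :
    Runs (.push k f) (r, S) (r, update S k (f r :: S k)) 1 :=
  ⟨1, le_rfl, .push ..⟩

theorem pop (k : K) (f : R → Option Γ → R) (r : R) (S : K → List Γ) :
    Runs (.pop k f) (r, S) (f r (S k).head?, update S k (S k).tail) 1 :=
  ⟨1, le_rfl, .pop ..⟩

theorem transfer {k : K} (ds : List K) (r : R) {S : K → List Γ} {a : Γ} {L : List Γ}
    (h : S k = a :: L) :
    Runs (.transfer k ds) (r, S) (r, pushAll a ds (update S k L)) 1 :=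
  ⟨1, le_rfl, .transfer _ _ _ _ _ _ h⟩

theorem seq (h₁ : Runs p c₁ c₂ n₁) (h₂ : Runs q c₂ c₃ n₂) : Runs (.seq p q) c₁ c₃ (n₁ + n₂) :=
  let ⟨_, l₁, e₁⟩ := h₁
  let ⟨_, l₂, e₂⟩ := h₂
  ⟨_, add_le_add l₁ l₂, .seq e₁ e₂⟩

theorem ite_true (hb : b c₁.1 (c₁.2 k).head? = true) (h : Runs p c₁ c₂ n) :
    Runs (.ite k b p q) c₁ c₂ (n + 1) :=
  let ⟨_, l, e⟩ := h
  ⟨_, Nat.succ_le_succ l, .ite_true hb e⟩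

theorem ite_false (hb : b c₁.1 (c₁.2 k).head? = false) (h : Runs q c₁ c₂ n) :
    Runs (.ite k b p q) c₁ c₂ (n + 1) :=
  let ⟨_, l, e⟩ := h
  ⟨_, Nat.succ_le_succ l, .ite_false hb e⟩

theorem loop_true (hb : b c₁.1 (c₁.2 k).head? = true) (h₁ : Runs p c₁ c₂ n₁)
    (h₂ : Runs (.loop k b p) c₂ c₃ n₂) : Runs (.loop k b p) c₁ c₃ (n₁ + n₂ + 1) :=
  let ⟨_, l₁, e₁⟩ := h₁
  let ⟨_, l₂, e₂⟩ := h₂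
  ⟨_, Nat.succ_le_succ (add_le_add l₁ l₂), .loop_true hb e₁ e₂⟩

theorem loop_false (hb : b c.1 (c.2 k).head? = false) : Runs (.loop k b p) c c 1 :=
  ⟨1, le_rfl, .loop_false hb⟩

end Runs

/-! ### Compilation to stack machines -/

/-- The labels of the machine that runs a program. -/
def Label : Prog K Γ R → Type
  | .load _ | .push _ _ | .pop _ _ | .transfer _ _ => Unit
  | .seq p q => p.Label ⊕ q.Label
  | .ite _ _ p q => Option (p.Label ⊕ q.Label)
  | .loop _ _ p => Option p.Label

/-- A program has finitely many labels. -/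
@[reducible]
def labelFintype : (p : Prog K Γ R) → Fintype p.Label
  | .load _ | .push _ _ | .pop _ _ | .transfer _ _ => inferInstanceAs (Fintype Unit)
  | .seq p q =>
    letI := labelFintype p
    letI := labelFintype q
    inferInstanceAs (Fintype (p.Label ⊕ q.Label))
  | .ite _ _ p q =>
    letI := labelFintype p
    letI := labelFintype q
    inferInstanceAs (Fintype (Option (p.Label ⊕ q.Label)))
  | .loop _ _ p =>
    letI := labelFintype p
    inferInstanceAs (Fintype (Option p.Label))

/-- The label at which a program starts. -/
def entry : (p : Prog K Γ R) → p.Label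
  | .load _ | .push _ _ | .pop _ _ | .transfer _ _ => ()
  | .seq p _ => Sum.inl p.entry
  | .ite _ _ _ _ | .loop _ _ _ => none

/-- Machine code that pushes the symbol in the second component of the state on some stacks. -/
def pushCode {Λ : Type} [Inhabited Γ] (exit : Λ) :
    List K → TM2.Stmt (fun _ : K => Γ) Λ (R × Option Γ)
  | [] => .load (fun s => (s.1, none)) (.goto fun _ => exit)
  | d :: ds => .push d (fun s => s.2.getD default) (pushCode exit ds)

/-- Machine code that tests the register and the top of a stack. -/
def testCode {Λ : Type} (k : K) (b : R → Option Γ → Bool) (l₁ l₂ : Λ) :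
    TM2.Stmt (fun _ : K => Γ) Λ (R × Option Γ) :=
  .peek k (fun s a => (s.1, a))
    (.branch (fun s => b s.1 s.2)
      (.load (fun s => (s.1, none)) (.goto fun _ => l₁))
      (.load (fun s => (s.1, none)) (.goto fun _ => l₂)))

/-- The machine code of a program, where `emb` places its labels among those of the machine and
`exit` is the label to go to at the end. -/
def code {Λ : Type} [Inhabited Γ] : (p : Prog K Γ R) → (emb : p.Label → Λ) → (exit : Λ) →
    p.Label → TM2.Stmt (fun _ : K => Γ) Λ (R × Option Γ)
  | .load f, _, exit, _ => .load (fun s => (f s.1, none)) (.goto fun _ => exit)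
  | .push k f, _, exit, _ => .push k (fun s => f s.1) (.goto fun _ => exit)
  | .pop k f, _, exit, _ => .pop k (fun s a => (f s.1 a, none)) (.goto fun _ => exit)
  | .transfer k ds, _, exit, _ => .pop k (fun s a => (s.1, a)) (pushCode exit ds)
  | .seq p q, emb, exit, l =>
    match l with
    | .inl l => code p (fun l => emb (.inl l)) (emb (.inr q.entry)) l
    | .inr l => code q (fun l => emb (.inr l)) exit l
  | .ite k b p q, emb, exit, l =>
    match l with
    | none => testCode k b (emb (some (.inl p.entry))) (emb (some (.inr q.entry)))
    | some (.inl l) => code p (fun l => emb (some (.inl l))) exit l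
    | some (.inr l) => code q (fun l => emb (some (.inr l))) exit l
  | .loop k b p, emb, exit, l =>
    match l with
    | none => testCode k b (emb (some p.entry)) exit
    | some l => code p (fun l => emb (some l)) (emb none) l

section Correctness

variable {Λ : Type}

/-- The machine configuration at a label. -/
def cfg (l : Λ) (c : Mem K Γ R) : TM2.Cfg (fun _ : K => Γ) Λ (R × Option Γ) :=
  ⟨some l, (c.1, none), c.2⟩

theorem stepAux_pushCode [Inhabited Γ] (exit : Λ) (ds : List K) (r : R) (a : Γ) (S : K → List Γ) :
    TM2.stepAux (pushCode exit ds) (r, some a) S = cfg exit (r, pushAll a ds S) := by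
  induction ds generalizing S with
  | nil => rfl
  | cons d ds ih => simp [pushCode, pushAll, ih]

theorem stepAux_testCode (k : K) (b : R → Option Γ → Bool) (l₁ l₂ : Λ) (c : Mem K Γ R) :
    TM2.stepAux (testCode k b l₁ l₂) (c.1, none) c.2 =
      cfg (cond (b c.1 (c.2 k).head?) l₁ l₂) c := by
  cases h : b c.1 (c.2 k).head? <;> simp [testCode, cfg, h]

/-- The machine `M` stays fixed while the induction passes to subprograms, whose labels are found
through a narrower `emb` and a different `exit`. A visit to a label is one machine step, and the
scratch component of the state is `none` at every label. A sequence only glues label sets, so it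
adds no step; a test is a label of its own and adds one. -/
theorem Exec.iterate_step [Inhabited Γ] {M : Λ → TM2.Stmt (fun _ : K => Γ) Λ (R × Option Γ)}
    {p : Prog K Γ R} {c c' : Mem K Γ R} {t : ℕ} (h : Exec p c t c') (emb : p.Label → Λ) (exit : Λ)
    (hM : ∀ l, M (emb l) = code p emb exit l) :
    (flip bind (TM2.step M))^[t] (some (cfg (emb p.entry) c)) = some (cfg exit c') := by
  have one (l : Λ) (c : Mem K Γ R) (d : TM2.Cfg (fun _ : K => Γ) Λ (R × Option Γ))
      (hd : TM2.stepAux (M l) (c.1, none) c.2 = d) :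
      flip bind (TM2.step M) (some (cfg l c)) = some d := by
    simp [flip, cfg, ← hd]
  have test (l l₁ l₂ : Λ) (k : K) (b : R → Option Γ → Bool) (c : Mem K Γ R)
      (hl : M l = testCode k b l₁ l₂) :
      flip bind (TM2.step M) (some (cfg l c)) = some (cfg (cond (b c.1 (c.2 k).head?) l₁ l₂) c) :=
    one _ _ _ (by rw [hl, stepAux_testCode])
  induction h generalizing exit with
  | load f r S => exact one _ _ _ (by rw [hM]; rfl)
  | push k f r S => exact one _ _ _ (by rw [hM]; rfl)
  | pop k f r S => exact one _ _ _ (by rw [hM]; rfl)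
  | transfer k ds r S a L h =>
    refine one _ _ _ ?_
    rw [hM]
    simp [code, h, stepAux_pushCode]
  | seq h₁ h₂ ih₁ ih₂ =>
    rw [Nat.add_comm, iterate_add_apply]
    refine (congrArg _ (ih₁ (fun l => emb (.inl l)) _ fun l => hM (.inl l))).trans ?_
    exact ih₂ (fun l => emb (.inr l)) _ fun l => hM (.inr l)
  | @ite_true k b p q c t c' hb h ih =>
    rw [iterate_succ_apply]
    refine (congrArg _ (test _ _ _ _ _ c (hM none))).trans ?_
    rw [hb]
    exact ih (fun l => emb (some (.inl l))) _ fun l => hM (some (.inl l))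
  | @ite_false k b p q c t c' hb h ih =>
    rw [iterate_succ_apply]
    refine (congrArg _ (test _ _ _ _ _ c (hM none))).trans ?_
    rw [hb]
    exact ih (fun l => emb (some (.inr l))) _ fun l => hM (some (.inr l))
  | @loop_true k b p c₁ t₁ c₂ t₂ c₃ hb h₁ h₂ ih₁ ih₂ =>
    rw [iterate_succ_apply]
    refine (congrArg _ (test _ _ _ _ _ c₁ (hM none))).trans ?_
    rw [hb, Nat.add_comm, iterate_add_apply]
    refine (congrArg _ (ih₁ (fun l => emb (some l)) _ fun l => hM (some l))).trans ?_
    exact ih₂ emb exit hM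
  | @loop_false k b p c hb =>
    exact (test _ _ _ _ _ _ (hM none)).trans (by rw [hb]; rfl)

end Correctness

/-- The stacks that are all empty but for one. -/
def onlyStack (k : K) (L : List Γ) : K → List Γ := fun k' => if k' = k then L else []

/-- The machine that runs a program. -/
def machine [Fintype K] [Fintype Γ] [Fintype R] [Inhabited Γ] (p : Prog K Γ R) (k₀ k₁ : K)
    (r₀ : R) : FinTM2 where
  K := K
  k₀ := k₀
  k₁ := k₁
  Γ := fun _ => Γ
  Λ := Option p.Label
  main := some p.entry
  ΛFin := letI := labelFintype p; inferInstanceAs (Fintype (Option p.Label))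
  σ := R × Option Γ
  initialState := (r₀, none)
  Γk₀Fin := inferInstanceAs (Fintype Γ)
  m := fun l => match l with
    | none => .halt
    | some l => code p some none l

/-- The compiled program exits to the extra label `none`, where one more step executes the halting
statement; hence `time + 1`. -/
theorem nonempty_polyTime [Fintype K] [Fintype Γ] [Fintype R] [Inhabited Γ] (p : Prog K Γ R)
    (k₀ k₁ : K) (r₀ : R) {α β : Type} (ea : α → List Γ) (eb : β → List Γ) (f : α → β)
    (time : Polynomial ℕ)
    (h : ∀ a, Runs p (r₀, onlyStack k₀ (ea a)) (r₀, onlyStack k₁ (eb (f a)))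
      (time.eval (ea a).length)) :
    Nonempty (TM2ComputableInPolyTime ea eb f) := by
  choose t ht e using h
  refine ⟨⟨⟨machine p k₀ k₁ r₀, Equiv.refl _, Equiv.refl _⟩, time + 1, fun a =>
    ⟨⟨t a + 1, ?_⟩, by simpa using ht a⟩⟩⟩
  rw [iterate_succ_apply']
  have hi : initList (machine p k₀ k₁ r₀) (List.map (Equiv.refl Γ).invFun (ea a)) =
      cfg (some p.entry) (r₀, onlyStack k₀ (ea a)) := by
    refine congrArg (TM2.Cfg.mk _ _) (funext fun (k : K) => ?_)
    by_cases hk : k = k₀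
    · refine (dif_pos hk).trans (Eq.trans ?_ (if_pos hk).symm)
      exact List.map_id _
    · exact (dif_neg hk).trans (if_neg hk).symm
  have ho : haltList (machine p k₀ k₁ r₀) (List.map (Equiv.refl Γ).invFun (eb (f a))) =
      ⟨none, (r₀, none), onlyStack k₁ (eb (f a))⟩ := by
    refine congrArg (TM2.Cfg.mk _ _) (funext fun (k : K) => ?_)
    by_cases hk : k = k₁
    · refine (dif_pos hk).trans (Eq.trans ?_ (if_pos hk).symm)
      exact List.map_id _
    · exact (dif_neg hk).trans (if_neg hk).symm
  have := (e a).iterate_step (M := (machine p k₀ k₁ r₀).m) some none fun l => rfl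
  refine (congrArg _ ((congrArg _ (congrArg some hi)).trans this)).trans ?_
  refine Eq.trans ?_ (congrArg some ho.symm)
  rfl

end Prog

end HornForget

namespace HornForget

/-! ### Lower bounds from essential clauses -/

theorem not_clause_iff {v : ℕ → Bool} {c : Clause} :
    (¬∃ l ∈ c, v l.1 = l.2) ↔ ∀ l ∈ c, v l.1 ≠ l.2 := by
  simp only [not_exists, not_and, ne_eq]

/-- A clause is essential in a formula if it is falsified by an assignment that becomes a model by
a change to the value of any one of its literals. -/
def IsEssential (A : CNF) (c : Clause) : Prop :=
  ∃ v : ℕ → Bool, (∀ l ∈ c, v l.1 ≠ l.2) ∧ ∀ l ∈ c, Models (Function.update v l.1 l.2) A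

/-- Only one value changes, so the literal that makes a previously false clause true can only be the
flipped one. -/
theorem mem_of_models_update {v : ℕ → Bool} {l : Literal} {d : Clause}
    (hd : ∀ l ∈ d, v l.1 ≠ l.2) (h : ∃ m ∈ d, Function.update v l.1 l.2 m.1 = m.2) : l ∈ d := by
  obtain ⟨m, hm, e⟩ := h
  by_cases hml : m.1 = l.1
  · rw [hml, Function.update_self] at e
    rwa [show l = m from Prod.ext hml.symm e]
  · rw [Function.update_of_ne hml] at e
    exact absurd e (hd m hm)

/-- If all the clauses of `G` are essential in `A` and `B` lies between `A` and `G`, then `B`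
contains supersets of the clauses of `G`, which are different from each other. -/
theorem exists_injOn_superset {A B G : CNF} (hess : ∀ c ∈ G, IsEssential A c)
    (hAB : Entails A B) (hBG : Entails B G) :
    ∃ D : Clause → Clause, (∀ c ∈ G, D c ∈ B ∧ c ⊆ D c) ∧ Set.InjOn D G := by
  -- The witness `v` of `c` falsifies `G`, hence some `d` in `B`. The last conjunct is stated for
  -- any consequence `d'` of `A`, so that it applies both to `d` and to the other clauses of `G`.
  have h : ∀ c ∈ G, ∃ v : ℕ → Bool, ∃ d ∈ B,
      (∀ l ∈ d, v l.1 ≠ l.2) ∧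
        ∀ d' : Clause, Entails A {d'} → (∀ l ∈ d', v l.1 ≠ l.2) → c ⊆ d' := by
    intro c hc
    obtain ⟨v, hv, hm⟩ := hess c hc
    have : ¬Models v B := fun hB => not_clause_iff.2 hv (hBG v hB c hc)
    simp only [Models, not_forall, not_clause_iff] at this
    obtain ⟨d, hd, hdv⟩ := this
    refine ⟨v, d, hd, hdv, fun d' hd' hv' l hl => ?_⟩
    exact mem_of_models_update hv' (hd' _ (hm l hl) d' (Finset.mem_singleton_self _))
  choose! v D hD hf hsub using h
  have hAd (c) (hc : c ∈ G) : Entails A {D c} := fun u hu d hd => by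
    rw [Finset.mem_singleton.1 hd]
    exact hAB u hu _ (hD c hc)
  have hAc (c) (hc : c ∈ G) : Entails A {c} := fun u hu d hd => by
    rw [Finset.mem_singleton.1 hd]
    exact hBG u (hAB u hu) _ hc
  have hs (c) (hc : c ∈ G) : c ⊆ D c := hsub c hc _ (hAd c hc) (hf c hc)
  refine ⟨D, fun c hc => ⟨hD c hc, hs c hc⟩, fun c hc c' hc' e => ?_⟩
  -- If `c` and `c'` have the same superset, each lies in a clause that is false at the witness of
  -- the other, so each contains the other.
  refine Finset.Subset.antisymm (hsub c hc _ (hAc c' hc') fun l hl => ?_)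
    (hsub c' hc' _ (hAc c hc) fun l hl => ?_)
  · exact hf c hc l (e ▸ hs c' hc' hl)
  · exact hf c' hc' l (e ▸ hs c hc hl)

theorem size_union {A B : CNF} (h : Disjoint A B) : size (A ∪ B) = size A + size B :=
  Finset.sum_union h

theorem size_mono {A B : CNF} (h : A ⊆ B) : size A ≤ size B :=
  Finset.sum_le_sum_of_subset h

/-- The lower bound on the size of a formula given by essential clauses and further clauses of the
formula that contain none of them, and the case of equality. -/
theorem size_add_size_le {A B G E : CNF} (hess : ∀ c ∈ G, IsEssential A c)
    (hAB : Entails A B) (hBG : Entails B G) (hE : E ⊆ B) (hGE : ∀ c ∈ G, ∀ d ∈ E, ¬c ⊆ d) :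
    size G + size E ≤ size B ∧ (size B ≤ size G + size E → ∅ ∉ B → B = G ∪ E) := by
  obtain ⟨D, hD, hinj⟩ := exists_injOn_superset hess hAB hBG
  have hdisj : Disjoint (G.image D) E := by
    rw [Finset.disjoint_left]
    rintro d hd hdE
    obtain ⟨c, hc, rfl⟩ := Finset.mem_image.1 hd
    exact hGE c hc _ hdE (hD c hc).2
  have hsub : G.image D ∪ E ⊆ B :=
    Finset.union_subset (Finset.image_subset_iff.2 fun c hc => (hD c hc).1) hE
  have hsize : size (G.image D) = ∑ c ∈ G, (D c).card := Finset.sum_image hinj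
  have hle : size G ≤ size (G.image D) :=
    hsize ▸ Finset.sum_le_sum fun c hc => Finset.card_le_card (hD c hc).2
  have htot := size_mono hsub
  rw [size_union hdisj] at htot
  refine ⟨by lia, fun hB hempty => ?_⟩
  have hcard : ∀ c ∈ G, c.card = (D c).card :=
    (Finset.sum_eq_sum_iff_of_le fun c hc => Finset.card_le_card (hD c hc).2).1
      (by change size G = _; lia)
  have hDc : ∀ c ∈ G, D c = c := fun c hc =>
    (Finset.eq_of_subset_of_card_le (hD c hc).2 (hcard c hc).ge).symm
  have himg : G.image D = G :=
    (Finset.image_congr (g := id) fun c hc => hDc c hc).trans Finset.image_id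
  rw [himg] at hsub hdisj
  -- Equality of sizes has forced `D c = c`. What is left of `B` has size zero and could only be the
  -- empty clause.
  refine (Finset.Subset.antisymm hsub fun d hd => ?_).symm
  by_contra hn
  have h1 : size (B \ (G ∪ E)) + size (G ∪ E) = size B := Finset.sum_sdiff hsub
  rw [size_union hdisj] at h1
  have h0 : size (B \ (G ∪ E)) = 0 := by lia
  have : d.card = 0 := Finset.sum_eq_zero_iff.1 h0 d (Finset.mem_sdiff.2 ⟨hd, hn⟩)
  exact hempty (Finset.card_eq_zero.1 this ▸ hd)

theorem isMinimal_of_isEssential {A : CNF} (h : ∀ c ∈ A, IsEssential A c) : IsMinimal A := by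
  intro B hB
  have := (size_add_size_le (E := ∅) h (fun v => (hB v).1) (fun v => (hB v).2)
    (Finset.empty_subset _) (by simp)).1
  simpa [size] using this

theorem entails_of_forgetting {A B : CNF} {Y : Finset ℕ} (h : ExpressesForgetting A Y B) :
    Entails A B :=
  (h.2 B h.1).1 fun _ hv => hv

/-! ### The variables of the reduction -/

/-- The variables of the formulae built by the reduction. Variable `lit b x` stands for the
literal `(x, b)` and `cl j` for the `j`-th clause, counting from one, of the given formula.
Variables `aux b x` and `goalAux` are those to forget. -/
inductive Var
  | lit (b : Bool) (x : ℕ)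
  | aux (b : Bool) (x : ℕ)
  | cl (j : ℕ)
  | start
  | goal
  | goalAux
  deriving DecidableEq

namespace Var

/-- Variables as numbers. -/
def name : Var → ℕ
  | lit b x => 16 * x + 8 + b.toNat
  | aux b x => 16 * x + 10 + b.toNat
  | cl j => 16 * (2 ^ j - 1) + 12
  | start => 13
  | goal => 14
  | goalAux => 15

/-- The residue modulo 16 is a tag for the kind and sign of a variable. All tags are at least 8, so
the fourth bit is set and four bits can be put before the binary name of `x` even when `x = 0`. The
parameter of `cl j` is coded as `2 ^ j - 1`, whose binary form is `j` ones: a counter kept in unary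
can be copied as it is. -/
theorem name_injective : Function.Injective name := by
  have hb (b : Bool) : b.toNat = 0 ∨ b.toNat = 1 := by cases b <;> simp
  have hbb (b b' : Bool) (h : b.toNat = b'.toNat) : b = b' := by cases b <;> cases b' <;> simp_all
  intro a a' h
  cases a with
  | lit b x =>
    cases a' with
    | lit b' x' =>
      simp only [name] at h
      have := hb b; have := hb b'
      rw [hbb b b' (by lia), show x = x' by lia]
    | aux b' x' => simp only [name] at h; have := hb b; have := hb b'; lia
    | _ => simp only [name] at h; have := hb b; lia
  | aux b x =>
    cases a' with
    | aux b' x' =>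
      simp only [name] at h
      have := hb b; have := hb b'
      rw [hbb b b' (by lia), show x = x' by lia]
    | lit b' x' => simp only [name] at h; have := hb b; have := hb b'; lia
    | _ => simp only [name] at h; have := hb b; lia
  | cl j =>
    cases a' with
    | lit b' x' => simp only [name] at h; have := hb b'; lia
    | aux b' x' => simp only [name] at h; have := hb b'; lia
    | cl j' =>
      simp only [name] at h
      have h1 : 0 < 2 ^ j := by positivity
      have h2 : 0 < 2 ^ j' := by positivity
      rw [Nat.pow_right_injective le_rfl (show 2 ^ j = 2 ^ j' by lia)]
    | _ => simp only [name] at h; lia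
  | _ =>
    cases a' with
    | lit b' x' => simp only [name] at h; have := hb b'; lia
    | aux b' x' => simp only [name] at h; have := hb b'; lia
    | cl j' => simp only [name] at h; lia
    | _ => simp_all [name]

theorem name_inj {a b : Var} : name a = name b ↔ a = b := name_injective.eq_iff

/-- A positive literal. -/
def pos (a : Var) : Literal := (a.name, true)

/-- A negative literal. -/
def neg (a : Var) : Literal := (a.name, false)

theorem pos_inj {a b : Var} : pos a = pos b ↔ a = b := by simp [pos, name_inj]

theorem neg_inj {a b : Var} : neg a = neg b ↔ a = b := by simp [neg, name_inj]

theorem pos_ne_neg (a b : Var) : pos a ≠ neg b := by simp [pos, neg]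

theorem neg_ne_pos (a b : Var) : neg a ≠ pos b := by simp [pos, neg]

open Classical in
/-- The assignment given by a set of variables. -/
noncomputable def assign (s : Var → Prop) (n : ℕ) : Bool := decide (∃ a, s a ∧ a.name = n)

theorem assign_name (s : Var → Prop) (a : Var) : assign s a.name = true ↔ s a := by
  simp [assign, name_inj]

theorem assign_pos (s : Var → Prop) (a : Var) : assign s (pos a).1 = (pos a).2 ↔ s a :=
  assign_name s a

theorem assign_neg (s : Var → Prop) (a : Var) : assign s (neg a).1 = (neg a).2 ↔ ¬s a := by
  simp [neg, ← assign_name s a]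

end Var

open Var

/-! ### The formulae of the reduction -/

/-- The clause `a → b`, as it is written. -/
def arrow (a b : Var) : List Literal := [neg a, pos b]

/-- The clause by which the goal and a literal over `x` imply the opposite literal. -/
def swap (b : Bool) (x : ℕ) : List Literal := [neg goal, neg (lit b x), pos (lit (!b) x)]

/-- The clauses written for an occurrence of a literal in the `j`-th clause. -/
def litClauses (j : ℕ) (l : Literal) : WrittenCNF :=
  [swap false l.1, swap true l.1,
   arrow start (aux false l.1), arrow (aux false l.1) (lit false l.1),
   arrow start (aux true l.1), arrow (aux true l.1) (lit true l.1),
   arrow (lit l.2 l.1) (cl j)]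

/-- The clauses written for a formula the clauses of which are numbered from `j + 1`. -/
def clausesFrom (j : ℕ) : WrittenCNF → WrittenCNF
  | [] => []
  | f :: F => f.flatMap (litClauses (j + 1)) ++ clausesFrom (j + 1) F

/-- The negations of the variables that stand for clauses numbered from `j + 1`. -/
def negFrom (j : ℕ) : WrittenCNF → List Literal
  | [] => []
  | _ :: F => neg (cl (j + 1)) :: negFrom (j + 1) F

/-- The variables to keep, for a formula the clauses of which are numbered from `j + 1`. -/
def keptFrom (j : ℕ) : WrittenCNF → List ℕ
  | [] => []
  | f :: F => (cl (j + 1)).name ::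
      (f.flatMap fun l => [(lit false l.1).name, (lit true l.1).name]) ++ keptFrom (j + 1) F

/-- The contribution to the size bound of the rest `f` of a clause, followed by `F`. -/
def litCount (f : List Literal) (F : WrittenCNF) : ℕ :=
  match f with
  | [] => 0
  | l :: f => (if l ∈ f then 0 else 2) + (if l.1 ∈ (f ++ F.flatten).map Prod.fst then 0 else 8) +
      litCount f F

/-- The contribution to the size bound of the clauses of a formula. -/
def count : WrittenCNF → ℕ
  | [] => 0
  | f :: F => 1 + litCount f F + count F

/-- The clause by which all clauses imply the goal. -/
def allClause (F : WrittenCNF) : List Literal := pos goal :: neg (cl 0) :: negFrom 0 F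

/-- The clauses that do not depend on the given formula. -/
def constClauses : WrittenCNF :=
  [arrow start (cl 0), arrow start goalAux, arrow goalAux goal]

/-- The reduction. -/
def reduction (F : WrittenCNF) : WrittenCNF × List ℕ × ℕ :=
  (constClauses ++ clausesFrom 0 F ++ [allClause F],
   [start.name, goal.name, (cl 0).name] ++ keptFrom 0 F, 4 + count F)

/-! ### Membership -/

/-- The variables of a written formula. -/
def occurring (F : WrittenCNF) : Finset ℕ := (F.flatten.map Prod.fst).toFinset

theorem mem_occurring {F : WrittenCNF} {x : ℕ} : x ∈ occurring F ↔ ∃ f ∈ F, ∃ b, (x, b) ∈ f := by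
  simp only [occurring, List.mem_toFinset, List.mem_map, List.mem_flatten, Prod.exists,
    exists_and_right, exists_eq_right]
  tauto

theorem mem_clausesFrom {j : ℕ} {F : WrittenCNF} {c : List Literal} :
    c ∈ clausesFrom j F ↔ ∃ i f l, F[i]? = some f ∧ l ∈ f ∧ c ∈ litClauses (j + i + 1) l := by
  induction F generalizing j with
  | nil => simp [clausesFrom]
  | cons f F ih =>
    simp only [clausesFrom, List.mem_append, List.mem_flatMap, ih]
    constructor
    · rintro (⟨l, hl, hc⟩ | ⟨i, g, l, hg, hl, hc⟩)
      · exact ⟨0, f, l, rfl, hl, hc⟩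
      · exact ⟨i + 1, g, l, by simpa using hg, hl, by rwa [← add_assoc, add_right_comm j i 1]⟩
    · rintro ⟨_ | i, g, l, hg, hl, hc⟩
      · simp only [List.getElem?_cons_zero, Option.some.injEq] at hg
        subst hg
        exact .inl ⟨l, hl, hc⟩
      · exact .inr ⟨i, g, l, by simpa using hg, hl, by rwa [add_right_comm j 1 i, add_assoc j]⟩

theorem mem_negFrom {j : ℕ} {F : WrittenCNF} {l : Literal} :
    l ∈ negFrom j F ↔ ∃ i < F.length, l = neg (cl (j + i + 1)) := by
  induction F generalizing j with
  | nil => simp [negFrom]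
  | cons f F ih =>
    simp only [negFrom, List.mem_cons, ih, List.length_cons]
    constructor
    · rintro (rfl | ⟨i, hi, rfl⟩)
      · exact ⟨0, by lia, rfl⟩
      · exact ⟨i + 1, by lia, by rw [add_right_comm j 1 i, add_assoc j]⟩
    · rintro ⟨_ | i, hi, rfl⟩
      · exact .inl rfl
      · exact .inr ⟨i, by lia, by rw [show j + (i + 1) + 1 = j + 1 + i + 1 by lia]⟩

theorem mem_keptFrom {j : ℕ} {F : WrittenCNF} {n : ℕ} :
    n ∈ keptFrom j F ↔ (∃ i < F.length, n = (cl (j + i + 1)).name) ∨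
      ∃ x ∈ occurring F, ∃ b, n = (lit b x).name := by
  induction F generalizing j with
  | nil => simp [keptFrom, mem_occurring]
  | cons f F ih =>
    simp only [keptFrom, List.cons_append, List.mem_cons, List.mem_append, List.mem_flatMap, ih,
      List.length_cons, List.not_mem_nil, or_false]
    constructor
    · rintro (rfl | ⟨l, hl, rfl | rfl⟩ | ⟨i, hi, rfl⟩ | ⟨x, hx, b, rfl⟩)
      · exact .inl ⟨0, by lia, rfl⟩
      · exact .inr ⟨l.1, mem_occurring.2 ⟨f, by simp, l.2, hl⟩, _, rfl⟩
      · exact .inr ⟨l.1, mem_occurring.2 ⟨f, by simp, l.2, hl⟩, _, rfl⟩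
      · exact .inl ⟨i + 1, by lia, by rw [add_right_comm j 1 i, add_assoc j]⟩
      · obtain ⟨g, hg, h⟩ := mem_occurring.1 hx
        exact .inr ⟨x, mem_occurring.2 ⟨g, by simp [hg], h⟩, b, rfl⟩
    · rintro (⟨_ | i, hi, rfl⟩ | ⟨x, hx, b, rfl⟩)
      · exact .inl rfl
      · exact .inr (.inr (.inl ⟨i, by lia, by rw [show j + (i + 1) + 1 = j + 1 + i + 1 by lia]⟩))
      · obtain ⟨g, hg, b', h⟩ := mem_occurring.1 hx
        rcases List.mem_cons.1 hg with rfl | hg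
        · exact .inr (.inl ⟨(x, b'), h, by cases b <;> simp⟩)
        · exact .inr (.inr (.inr ⟨x, mem_occurring.2 ⟨g, hg, b', h⟩, b, rfl⟩))

end HornForget

namespace HornForget

open Var

/-! ### Models of the reduced formula -/

/-- The clauses of the reduced formula that do not contain variables to forget. -/
inductive IsFixed (F : WrittenCNF) : Clause → Prop
  | swap (b x) (hx : x ∈ occurring F) : IsFixed F (swap b x).toFinset
  | sat (i f l) (hf : F[i]? = some f) (hl : l ∈ f) :
      IsFixed F (arrow (lit l.2 l.1) (cl (i + 1))).toFinset
  | all : IsFixed F (allClause F).toFinset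
  | init : IsFixed F (arrow start (cl 0)).toFinset

/-- The clauses of the reduced formula that contain variables to forget. -/
inductive IsBridge (F : WrittenCNF) : Clause → Prop
  | start_aux (b x) (hx : x ∈ occurring F) : IsBridge F (arrow start (aux b x)).toFinset
  | aux_lit (b x) (hx : x ∈ occurring F) : IsBridge F (arrow (aux b x) (lit b x)).toFinset
  | start_goalAux : IsBridge F (arrow start goalAux).toFinset
  | goalAux_goal : IsBridge F (arrow goalAux goal).toFinset

theorem mem_reduction {F : WrittenCNF} {c : Clause} :
    c ∈ (reduction F).1.toCNF ↔ IsFixed F c ∨ IsBridge F c := by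
  simp only [WrittenCNF.toCNF, reduction, constClauses, List.mem_toFinset, List.mem_map,
    List.mem_append, List.mem_cons, List.not_mem_nil, or_false, mem_clausesFrom, zero_add]
  constructor
  · rintro ⟨c, ((rfl | rfl | rfl) | ⟨i, f, l, hf, hl, hc⟩) | rfl, rfl⟩
    · exact .inl .init
    · exact .inr .start_goalAux
    · exact .inr .goalAux_goal
    · have hx : l.1 ∈ occurring F := mem_occurring.2 ⟨f, List.mem_of_getElem? hf, l.2, hl⟩
      simp only [litClauses, List.mem_cons, List.not_mem_nil, or_false] at hc
      rcases hc with rfl | rfl | rfl | rfl | rfl | rfl | rfl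
      exacts [.inl (.swap _ _ hx), .inl (.swap _ _ hx), .inr (.start_aux _ _ hx),
        .inr (.aux_lit _ _ hx), .inr (.start_aux _ _ hx), .inr (.aux_lit _ _ hx),
        .inl (.sat _ _ _ hf hl)]
    · exact .inl .all
  · have key (x) (hx : x ∈ occurring F) :
        ∃ (i : ℕ) (f : List Literal) (b : Bool), F[i]? = some f ∧ (x, b) ∈ f := by
      obtain ⟨f, hf, b, hb⟩ := mem_occurring.1 hx
      obtain ⟨i, hi⟩ := List.mem_iff_getElem?.1 hf
      exact ⟨i, f, b, hi, hb⟩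
    rintro ((⟨b, x, hx⟩ | ⟨i, f, l, hf, hl⟩ | _ | _) | (⟨b, x, hx⟩ | ⟨b, x, hx⟩ | _ | _))
    · obtain ⟨i, f, b', hf, hb⟩ := key x hx
      exact ⟨_, .inl (.inr ⟨i, f, _, hf, hb, by cases b <;> simp [litClauses]⟩), rfl⟩
    · exact ⟨_, .inl (.inr ⟨i, f, l, hf, hl, by simp [litClauses]⟩), rfl⟩
    · exact ⟨_, .inr rfl, rfl⟩
    · exact ⟨_, .inl (.inl (.inl rfl)), rfl⟩
    · obtain ⟨i, f, b', hf, hb⟩ := key x hx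
      exact ⟨_, .inl (.inr ⟨i, f, _, hf, hb, by cases b <;> simp [litClauses]⟩), rfl⟩
    · obtain ⟨i, f, b', hf, hb⟩ := key x hx
      exact ⟨_, .inl (.inr ⟨i, f, _, hf, hb, by cases b <;> simp [litClauses]⟩), rfl⟩
    · exact ⟨_, .inl (.inl (.inr (.inl rfl))), rfl⟩
    · exact ⟨_, .inl (.inl (.inr (.inr rfl))), rfl⟩

/-- The sets of variables that satisfy the fixed clauses. -/
structure FixedModel (F : WrittenCNF) (s : Var → Prop) : Prop where
  swap : ∀ x ∈ occurring F, ∀ b, s goal → s (lit b x) → s (lit (!b) x)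
  sat : ∀ i f x b, F[i]? = some f → (x, b) ∈ f → s (lit b x) → s (cl (i + 1))
  all : s (cl 0) → (∀ i < F.length, s (cl (i + 1))) → s goal
  init : s start → s (cl 0)

/-- The sets of variables that satisfy the other clauses of the reduced formula. -/
structure BridgeModel (F : WrittenCNF) (s : Var → Prop) : Prop where
  start_aux : ∀ x ∈ occurring F, ∀ b, s start → s (aux b x)
  aux_lit : ∀ x ∈ occurring F, ∀ b, s (aux b x) → s (lit b x)
  start_goalAux : s start → s goalAux
  goalAux_goal : s goalAux → s goal

/-- The set of variables that are true in an assignment. -/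
def trueVars (v : ℕ → Bool) (a : Var) : Prop := v a.name = true

theorem trueVars_assign (s : Var → Prop) : trueVars (assign s) = s :=
  funext fun a => propext (assign_name s a)

theorem eval_pos {v : ℕ → Bool} {a : Var} : v (pos a).1 = (pos a).2 ↔ trueVars v a := Iff.rfl

theorem eval_neg {v : ℕ → Bool} {a : Var} : v (neg a).1 = (neg a).2 ↔ ¬trueVars v a := by
  simp [neg, trueVars]

theorem eval_arrow {v : ℕ → Bool} {a b : Var} :
    (∃ l ∈ (arrow a b).toFinset, v l.1 = l.2) ↔ (trueVars v a → trueVars v b) := by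
  simp only [arrow, List.mem_toFinset, List.mem_cons, List.not_mem_nil, or_false,
    exists_eq_or_imp, exists_eq_left, eval_pos, eval_neg]
  tauto

theorem eval_swap {v : ℕ → Bool} {b : Bool} {x : ℕ} :
    (∃ l ∈ (swap b x).toFinset, v l.1 = l.2) ↔
      (trueVars v goal → trueVars v (lit b x) → trueVars v (lit (!b) x)) := by
  simp only [swap, List.mem_toFinset, List.mem_cons, List.not_mem_nil, or_false,
    exists_eq_or_imp, exists_eq_left, eval_pos, eval_neg]
  tauto

theorem mem_allClause {F : WrittenCNF} {l : Literal} : l ∈ allClause F ↔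
    l = pos goal ∨ l = neg (cl 0) ∨ ∃ i < F.length, l = neg (cl (i + 1)) := by
  simp [allClause, mem_negFrom]

theorem eval_allClause {v : ℕ → Bool} {F : WrittenCNF} :
    (∃ l ∈ (allClause F).toFinset, v l.1 = l.2) ↔ (trueVars v (cl 0) →
      (∀ i < F.length, trueVars v (cl (i + 1))) → trueVars v goal) := by
  simp only [List.mem_toFinset, mem_allClause]
  constructor
  · rintro ⟨l, rfl | rfl | ⟨i, hi, rfl⟩, h⟩ h0 hall
    · exact eval_pos.1 h
    · exact absurd h0 (eval_neg.1 h)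
    · exact absurd (hall i hi) (eval_neg.1 h)
  · intro h
    by_cases h0 : trueVars v (cl 0)
    · by_cases hall : ∀ i < F.length, trueVars v (cl (i + 1))
      · exact ⟨_, .inl rfl, eval_pos.2 (h h0 hall)⟩
      · push Not at hall
        obtain ⟨i, hi, hn⟩ := hall
        exact ⟨_, .inr (.inr ⟨i, hi, rfl⟩), eval_neg.2 hn⟩
    · exact ⟨_, .inr (.inl rfl), eval_neg.2 h0⟩

theorem fixedModel_iff {v : ℕ → Bool} {F : WrittenCNF} :
    (∀ c, IsFixed F c → ∃ l ∈ c, v l.1 = l.2) ↔ FixedModel F (trueVars v) := by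
  constructor
  · intro h
    exact ⟨fun x hx b => eval_swap.1 (h _ (.swap b x hx)),
      fun i f x b hf hl => eval_arrow.1 (h _ (.sat i f (x, b) hf hl)),
      eval_allClause.1 (h _ .all), eval_arrow.1 (h _ .init)⟩
  · rintro h c (⟨b, x, hx⟩ | ⟨i, f, l, hf, hl⟩ | _ | _)
    exacts [eval_swap.2 (h.swap x hx b), eval_arrow.2 (h.sat i f _ _ hf hl),
      eval_allClause.2 h.all, eval_arrow.2 h.init]

theorem bridgeModel_iff {v : ℕ → Bool} {F : WrittenCNF} :
    (∀ c, IsBridge F c → ∃ l ∈ c, v l.1 = l.2) ↔ BridgeModel F (trueVars v) := by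
  constructor
  · intro h
    exact ⟨fun x hx b => eval_arrow.1 (h _ (.start_aux b x hx)),
      fun x hx b => eval_arrow.1 (h _ (.aux_lit b x hx)),
      eval_arrow.1 (h _ .start_goalAux), eval_arrow.1 (h _ .goalAux_goal)⟩
  · rintro h c (⟨b, x, hx⟩ | ⟨b, x, hx⟩ | _ | _)
    exacts [eval_arrow.2 (h.start_aux x hx b), eval_arrow.2 (h.aux_lit x hx b),
      eval_arrow.2 h.start_goalAux, eval_arrow.2 h.goalAux_goal]

theorem models_reduction {v : ℕ → Bool} {F : WrittenCNF} : Models v (reduction F).1.toCNF ↔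
    FixedModel F (trueVars v) ∧ BridgeModel F (trueVars v) := by
  simp only [Models, mem_reduction, ← fixedModel_iff, ← bridgeModel_iff]
  exact ⟨fun h => ⟨fun c hc => h c (.inl hc), fun c hc => h c (.inr hc)⟩,
    fun h c hc => hc.elim (h.1 c) (h.2 c)⟩

/-! ### Minimality of the reduced formula -/

/-- A literal is false in `s`, and true after a change that turns `s` into a model. -/
inductive FlipsToModel (F : WrittenCNF) (s : Var → Prop) : Literal → Prop
  | pos (a) (ha : ¬s a) (h : FixedModel F fun b => b = a ∨ s b)
      (h' : BridgeModel F fun b => b = a ∨ s b) : FlipsToModel F s (pos a)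
  | neg (a) (ha : s a) (h : FixedModel F fun b => b ≠ a ∧ s b)
      (h' : BridgeModel F fun b => b ≠ a ∧ s b) : FlipsToModel F s (neg a)

theorem isEssential_of_flipsToModel {F : WrittenCNF} (s : Var → Prop) {c : List Literal}
    (h : ∀ l ∈ c, FlipsToModel F s l) : IsEssential (reduction F).1.toCNF c.toFinset := by
  refine ⟨assign s, fun l hl => ?_, fun l hl => models_reduction.2 ?_⟩
  · obtain ⟨a, ha, -, -⟩ | ⟨a, ha, -, -⟩ := h l (List.mem_toFinset.1 hl)
    · exact fun e => ha ((assign_pos s a).1 e)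
    · exact fun e => (assign_neg s a).1 e ha
  · obtain ⟨a, ha, hf, hb⟩ | ⟨a, ha, hf, hb⟩ := h l (List.mem_toFinset.1 hl)
    · have : trueVars (Function.update (assign s) (pos a).1 (pos a).2) = fun b => b = a ∨ s b := by
        funext b
        by_cases hba : b = a
        · simp [trueVars, pos, hba]
        · simp [trueVars, pos, name_inj, hba, assign_name]
      rw [this]
      exact ⟨hf, hb⟩
    · have : trueVars (Function.update (assign s) (neg a).1 (neg a).2) = fun b => b ≠ a ∧ s b := by
        funext b
        by_cases hba : b = a
        · simp [trueVars, neg, hba]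
        · simp [trueVars, neg, name_inj, hba, assign_name]
      rw [this]
      exact ⟨hf, hb⟩

theorem flipsToModel_arrow {F : WrittenCNF} {s : Var → Prop} {a b : Var}
    (ha : FlipsToModel F s (neg a)) (hb : FlipsToModel F s (pos b)) :
    ∀ l ∈ arrow a b, FlipsToModel F s l := by
  simp [arrow, ha, hb]

/-- All `cl (i + 1)` are true, so that literals can be switched on freely, and `cl 0` is false, so
that they do not force `goal`. This is why `cl 0` exists: without it, a literal that implied every
clause of `F` would imply `goal`, and this premise could be dropped from `swap`. -/
theorem isEssential_swap {F : WrittenCNF} {b : Bool} {x : ℕ} :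
    IsEssential (reduction F).1.toCNF (swap b x).toFinset := by
  refine isEssential_of_flipsToModel
    (fun a => a = goal ∨ a = lit b x ∨ ∃ i, a = cl (i + 1)) ?_
  simp only [swap, List.mem_cons, List.not_mem_nil, or_false, forall_eq_or_imp, forall_eq]
  refine ⟨.neg _ (by simp) ?_ ?_, .neg _ (by simp) ?_ ?_, .pos _ (by simp) ?_ ?_⟩ <;>
    constructor <;> cases b <;> grind

/-- Again `cl 0` is false, so switching on the one missing `cl (i + 1)` does not force `goal`. -/
theorem isEssential_sat {F : WrittenCNF} {b : Bool} {x i : ℕ} :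
    IsEssential (reduction F).1.toCNF (arrow (lit b x) (cl (i + 1))).toFinset := by
  refine isEssential_of_flipsToModel
    (fun a => a = lit b x ∨ ∃ j, j ≠ i ∧ a = cl (j + 1)) (flipsToModel_arrow ?_ ?_)
  · refine .neg _ (by simp) ?_ ?_ <;> constructor <;> grind
  · refine .pos _ (by simp) ?_ ?_ <;> constructor <;> grind

/-- Exactly the `cl j` are true. No literal is, so `goal` can be switched on without triggering a
swap. -/
theorem isEssential_all {F : WrittenCNF} :
    IsEssential (reduction F).1.toCNF (allClause F).toFinset := by
  refine isEssential_of_flipsToModel (fun a => ∃ j, a = cl j) fun l hl => ?_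
  rcases mem_allClause.1 hl with rfl | rfl | ⟨i, hi, rfl⟩
  · refine .pos _ (by simp) ?_ ?_ <;> constructor <;> grind
  · refine .neg _ (by simp) ?_ ?_ <;> constructor <;> grind
  · refine .neg _ (by simp) ?_ ?_ <;> constructor <;> grind

/-- Everything but the conclusion is true. No clause other than this one has this conclusion, so
switching `start` off repairs the assignment, as does switching the conclusion on. The same witness
works for `aux b x` and `goalAux` below. -/
theorem isEssential_init {F : WrittenCNF} :
    IsEssential (reduction F).1.toCNF (arrow start (cl 0)).toFinset := by
  refine isEssential_of_flipsToModel (fun a => a ≠ cl 0) (flipsToModel_arrow ?_ ?_)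
  · refine .neg _ (by simp) ?_ ?_ <;> constructor <;> grind
  · refine .pos _ (by simp) ?_ ?_ <;> constructor <;> grind

theorem isEssential_start_aux {F : WrittenCNF} {b : Bool} {x : ℕ} :
    IsEssential (reduction F).1.toCNF (arrow start (aux b x)).toFinset := by
  refine isEssential_of_flipsToModel (fun a => a ≠ aux b x) (flipsToModel_arrow ?_ ?_)
  · refine .neg _ (by simp) ?_ ?_ <;> constructor <;> grind
  · refine .pos _ (by simp) ?_ ?_ <;> constructor <;> grind

/-- The `cl (i + 1)` are true to allow `lit b x` to be switched on; `goal` stays false because `cl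
0` does. -/
theorem isEssential_aux_lit {F : WrittenCNF} {b : Bool} {x : ℕ} :
    IsEssential (reduction F).1.toCNF (arrow (aux b x) (lit b x)).toFinset := by
  refine isEssential_of_flipsToModel (fun a => a = aux b x ∨ ∃ i, a = cl (i + 1))
    (flipsToModel_arrow ?_ ?_)
  · refine .neg _ (by simp) ?_ ?_ <;> constructor <;> grind
  · refine .pos _ (by simp) ?_ ?_ <;> constructor <;> grind

theorem isEssential_start_goalAux {F : WrittenCNF} :
    IsEssential (reduction F).1.toCNF (arrow start goalAux).toFinset := by
  refine isEssential_of_flipsToModel (fun a => a ≠ goalAux) (flipsToModel_arrow ?_ ?_)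
  · refine .neg _ (by simp) ?_ ?_ <;> constructor <;> grind
  · refine .pos _ (by simp) ?_ ?_ <;> constructor <;> grind

theorem isEssential_goalAux_goal {F : WrittenCNF} :
    IsEssential (reduction F).1.toCNF (arrow goalAux goal).toFinset := by
  refine isEssential_of_flipsToModel (fun a => a = goalAux) (flipsToModel_arrow ?_ ?_)
  · refine .neg _ (by simp) ?_ ?_ <;> constructor <;> grind
  · refine .pos _ (by simp) ?_ ?_ <;> constructor <;> grind

theorem isEssential_of_mem {F : WrittenCNF} {c : Clause} (h : c ∈ (reduction F).1.toCNF) :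
    IsEssential (reduction F).1.toCNF c := by
  rcases mem_reduction.1 h with
    (⟨b, x, hx⟩ | ⟨i, f, l, hf, hl⟩ | _ | _) | (⟨b, x, hx⟩ | ⟨b, x, hx⟩ | _ | _)
  exacts [isEssential_swap, isEssential_sat, isEssential_all,
    isEssential_init, isEssential_start_aux, isEssential_aux_lit, isEssential_start_goalAux,
    isEssential_goalAux_goal]

theorem isMinimal_reduction (F : WrittenCNF) : IsMinimal (reduction F).1.toCNF :=
  isMinimal_of_isEssential fun _ => isEssential_of_mem

end HornForget

namespace HornForget

open Var

/-! ### Sizes -/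

theorem mem_arrow {a b : Var} {l : Literal} :
    l ∈ (arrow a b).toFinset ↔ l = neg a ∨ l = pos b := by
  simp [arrow]

theorem pos_mem_arrow {a b c : Var} : pos c ∈ (arrow a b).toFinset ↔ c = b := by
  rw [mem_arrow]
  simp [pos_inj, pos_ne_neg]

theorem neg_mem_arrow {a b c : Var} : neg c ∈ (arrow a b).toFinset ↔ c = a := by
  rw [mem_arrow]
  simp [neg_inj, neg_ne_pos]

theorem pos_mem_swap {b : Bool} {x : ℕ} {a : Var} :
    pos a ∈ (swap b x).toFinset ↔ a = lit (!b) x := by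
  simp [swap, pos_inj, pos_ne_neg]

theorem neg_mem_swap {b : Bool} {x : ℕ} {a : Var} :
    neg a ∈ (swap b x).toFinset ↔ a = goal ∨ a = lit b x := by
  simp [swap, neg_inj, neg_ne_pos]

theorem pos_mem_allClause {F : WrittenCNF} {a : Var} :
    pos a ∈ (allClause F).toFinset ↔ a = goal := by
  simp [mem_allClause, pos_inj, pos_ne_neg]

theorem neg_mem_allClause {F : WrittenCNF} {a : Var} :
    neg a ∈ (allClause F).toFinset ↔ a = cl 0 ∨ ∃ i < F.length, a = cl (i + 1) := by
  simp [mem_allClause, neg_inj, neg_ne_pos]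

theorem arrow_inj {a b a' b' : Var} (h : (arrow a b).toFinset = (arrow a' b').toFinset) :
    a = a' ∧ b = b' :=
  ⟨neg_mem_arrow.1 (h ▸ neg_mem_arrow.2 rfl), pos_mem_arrow.1 (h ▸ pos_mem_arrow.2 rfl)⟩

theorem swap_inj {b b' : Bool} {x x' : ℕ} (h : (swap b x).toFinset = (swap b' x').toFinset) :
    b = b' ∧ x = x' := by
  have : pos (lit (!b) x) ∈ (swap b' x').toFinset := h ▸ pos_mem_swap.2 rfl
  simpa using pos_mem_swap.1 this

theorem card_arrow (a b : Var) : (arrow a b).toFinset.card = 2 := by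
  rw [List.card_toFinset, List.dedup_eq_self.2 (by simp [arrow, neg_ne_pos])]
  rfl

theorem card_swap (b : Bool) (x : ℕ) : (swap b x).toFinset.card = 3 := by
  rw [List.card_toFinset, List.dedup_eq_self.2 (by simp [swap, neg_ne_pos, neg_inj])]
  rfl

theorem length_negFrom (j : ℕ) (F : WrittenCNF) : (negFrom j F).length = F.length := by
  induction F generalizing j with
  | nil => rfl
  | cons f F ih => simp [negFrom, ih]

theorem nodup_negFrom (j : ℕ) (F : WrittenCNF) : (negFrom j F).Nodup := by
  induction F generalizing j with
  | nil => exact List.nodup_nil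
  | cons f F ih =>
    refine List.nodup_cons.2 ⟨fun h => ?_, ih _⟩
    obtain ⟨i, -, e⟩ := mem_negFrom.1 h
    rw [neg_inj, cl.injEq] at e
    lia

theorem card_allClause (F : WrittenCNF) : (allClause F).toFinset.card = F.length + 2 := by
  rw [List.card_toFinset, List.dedup_eq_self.2]
  · simp [allClause, length_negFrom]
  · simp [allClause, nodup_negFrom, mem_negFrom, pos_ne_neg, neg_inj]

/-- The clauses by which goal and a literal imply the opposite literal. -/
def swaps (F : WrittenCNF) : CNF :=
  (occurring F ×ˢ Finset.univ).image fun p => (swap p.2 p.1).toFinset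

/-- The clauses by which a literal implies the clauses it occurs in. -/
def sats (F : WrittenCNF) : CNF :=
  ((Finset.range F.length).sigma fun i => (F.getD i []).toFinset).image
    fun p => (arrow (lit p.2.2 p.2.1) (cl (p.1 + 1))).toFinset

/-- The clauses of the reduced formula without variables to forget. -/
def fixed (F : WrittenCNF) : CNF :=
  {(allClause F).toFinset, (arrow start (cl 0)).toFinset} ∪ (swaps F ∪ sats F)

theorem mem_fixed {F : WrittenCNF} {c : Clause} : c ∈ fixed F ↔ IsFixed F c := by
  simp only [fixed, swaps, sats, Finset.mem_union, Finset.mem_insert, Finset.mem_singleton,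
    Finset.mem_image, Finset.mem_product, Finset.mem_univ, and_true, Finset.mem_sigma,
    Finset.mem_range, List.mem_toFinset, Prod.exists, Sigma.exists]
  constructor
  · rintro ((rfl | rfl) | ⟨x, b, hx, rfl⟩ | ⟨i, x, b, ⟨hi, hl⟩, rfl⟩)
    · exact .all
    · exact .init
    · exact .swap b x hx
    · rw [List.getD_eq_getElem _ _ hi] at hl
      exact .sat i _ (x, b) (List.getElem?_eq_getElem hi) hl
  · rintro (⟨b, x, hx⟩ | ⟨i, f, ⟨x, b⟩, hf, hl⟩ | _ | _)
    · exact .inr (.inl ⟨x, b, hx, rfl⟩)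
    · obtain ⟨hi, rfl⟩ := List.getElem?_eq_some_iff.1 hf
      exact .inr (.inr ⟨i, x, b, ⟨hi, by rwa [List.getD_eq_getElem _ _ hi]⟩, rfl⟩)
    · exact .inl (.inl rfl)
    · exact .inl (.inr rfl)

theorem size_swaps (F : WrittenCNF) : size (swaps F) = 6 * (occurring F).card := by
  rw [size, swaps, Finset.sum_image, Finset.sum_congr rfl fun p _ => card_swap p.2 p.1]
  · simp
    ring
  · intro p _ q _ h
    exact Prod.ext (swap_inj h).2 (swap_inj h).1

theorem sum_range_card_getD (F : WrittenCNF) :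
    ∑ i ∈ Finset.range F.length, (F.getD i []).toFinset.card =
      (F.map fun f => f.toFinset.card).sum := by
  induction F with
  | nil => rfl
  | cons f F ih =>
    rw [List.length_cons, Finset.sum_range_succ', List.map_cons, List.sum_cons, ← ih, add_comm]
    rfl

theorem size_sats (F : WrittenCNF) :
    size (sats F) = 2 * (F.map fun f => f.toFinset.card).sum := by
  rw [size, sats, Finset.sum_image, Finset.sum_congr rfl fun p _ => card_arrow _ _]
  · rw [← sum_range_card_getD, Finset.sum_const, Finset.card_sigma, smul_eq_mul, mul_comm]
  · rintro ⟨i, x, b⟩ _ ⟨i', x', b'⟩ _ h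
    have := arrow_inj h
    simp_all

theorem size_fixed (F : WrittenCNF) : size (fixed F) =
    F.length + 4 + 6 * (occurring F).card + 2 * (F.map fun f => f.toFinset.card).sum := by
  have hne : (allClause F).toFinset ≠ (arrow start (cl 0)).toFinset := fun h => by
    have : pos goal ∈ (arrow start (cl 0)).toFinset := h ▸ pos_mem_allClause.2 rfl
    exact absurd (pos_mem_arrow.1 this) (by simp)
  have hd1 : Disjoint (swaps F) (sats F) := by
    simp only [swaps, sats, Finset.disjoint_left, Finset.mem_image]
    rintro _ ⟨p, -, rfl⟩ ⟨q, -, h⟩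
    have : neg goal ∈ (arrow (lit q.2.2 q.2.1) (cl (q.1 + 1))).toFinset :=
      h ▸ neg_mem_swap.2 (.inl rfl)
    exact absurd (neg_mem_arrow.1 this) (by simp)
  have hd2 : Disjoint ({(allClause F).toFinset, (arrow start (cl 0)).toFinset} : CNF)
      (swaps F ∪ sats F) := by
    simp only [swaps, sats, Finset.disjoint_left, Finset.mem_insert, Finset.mem_singleton,
      Finset.mem_union, Finset.mem_image]
    rintro _ (rfl | rfl) (⟨p, -, h⟩ | ⟨p, -, h⟩)
    · have : pos goal ∈ (swap p.2 p.1).toFinset := h ▸ pos_mem_allClause.2 rfl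
      exact absurd (pos_mem_swap.1 this) (by simp)
    · have : pos goal ∈ (arrow (lit p.2.2 p.2.1) (cl (p.1 + 1))).toFinset :=
        h ▸ pos_mem_allClause.2 rfl
      exact absurd (pos_mem_arrow.1 this) (by simp)
    · have : pos (cl 0) ∈ (swap p.2 p.1).toFinset := h ▸ pos_mem_arrow.2 rfl
      exact absurd (pos_mem_swap.1 this) (by simp)
    · simpa using arrow_inj h
  rw [fixed, size_union hd2, size_union hd1, size_swaps, size_sats, size, Finset.sum_pair hne,
    card_allClause, card_arrow]
  ring

/-- A literal is counted at its last occurrence in its clause and a variable at its last occurrence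
in the formula, so repetitions do not matter. A literal costs the 2 of its clause `lit → cl`; a
variable costs 8, two swaps of size 3 and one choice clause of size 2. -/
theorem litCount_add (f : List Literal) (F : WrittenCNF) :
    litCount f F + 8 * (occurring F).card =
      2 * f.toFinset.card + 8 * (occurring (f :: F)).card := by
  induction f with
  | nil => simp [litCount, occurring]
  | cons l f ih =>
    have h : occurring ((l :: f) :: F) = insert l.1 (occurring (f :: F)) := by simp [occurring]
    have h' : l.1 ∈ (f ++ F.flatten).map Prod.fst ↔ l.1 ∈ occurring (f :: F) := by
      simp only [occurring, List.mem_toFinset, List.flatten_cons]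
    rw [litCount, h, List.toFinset_cons, Finset.card_insert_eq_ite, Finset.card_insert_eq_ite]
    simp only [h', List.mem_toFinset]
    split_ifs <;> lia

theorem count_eq (F : WrittenCNF) : count F =
    F.length + 8 * (occurring F).card + 2 * (F.map fun f => f.toFinset.card).sum := by
  induction F with
  | nil => rfl
  | cons f F ih =>
    have := litCount_add f F
    simp only [count, List.length_cons, List.map_cons, List.sum_cons]
    lia

/-- The constant 4 in `reduction` is made of `goal` and `cl 0` in `allClause` and the two literals
of `start → cl 0`. -/
theorem count_eq_size (F : WrittenCNF) :
    (reduction F).2.2 = size (fixed F) + 2 * (occurring F).card := by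
  rw [size_fixed]
  change 4 + count F = _
  rw [count_eq]
  ring

/-! ### Variables, Horn form, absence of tautologies -/

theorem mem_kept {F : WrittenCNF} {n : ℕ} : n ∈ (reduction F).2.1.toFinset ↔
    n = start.name ∨ n = goal.name ∨ (∃ i ≤ F.length, n = (cl i).name) ∨
      ∃ x ∈ occurring F, ∃ b, n = (lit b x).name := by
  simp only [reduction, List.mem_toFinset, List.mem_append, List.mem_cons, List.not_mem_nil,
    or_false, mem_keptFrom, zero_add]
  constructor
  · rintro ((h | h | rfl) | (⟨i, hi, rfl⟩ | h))
    · exact .inl h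
    · exact .inr (.inl h)
    · exact .inr (.inr (.inl ⟨0, by lia, rfl⟩))
    · exact .inr (.inr (.inl ⟨i + 1, by lia, rfl⟩))
    · exact .inr (.inr (.inr h))
  · rintro (h | h | ⟨_ | i, hi, rfl⟩ | h)
    · exact .inl (.inl h)
    · exact .inl (.inr (.inl h))
    · exact .inl (.inr (.inr rfl))
    · exact .inr (.inl ⟨i, by lia, rfl⟩)
    · exact .inr (.inr h)

theorem mem_vars {A : CNF} {n : ℕ} : n ∈ vars A ↔ ∃ c ∈ A, ∃ l ∈ c, l.1 = n := by
  simp [vars]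

theorem kept_subset_vars (F : WrittenCNF) :
    (reduction F).2.1.toFinset ⊆ vars (reduction F).1.toCNF := by
  intro n hn
  rw [mem_vars]
  rcases mem_kept.1 hn with rfl | rfl | ⟨_ | i, hi, rfl⟩ | ⟨x, hx, b, rfl⟩
  · exact ⟨_, mem_reduction.2 (.inl .init), neg start, neg_mem_arrow.2 rfl, rfl⟩
  · exact ⟨_, mem_reduction.2 (.inl .all), pos goal, pos_mem_allClause.2 rfl, rfl⟩
  · exact ⟨_, mem_reduction.2 (.inl .init), pos (cl 0), pos_mem_arrow.2 rfl, rfl⟩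
  · exact ⟨_, mem_reduction.2 (.inl .all), neg (cl (i + 1)),
      neg_mem_allClause.2 (.inr ⟨i, by lia, rfl⟩), rfl⟩
  · exact ⟨_, mem_reduction.2 (.inr (.aux_lit b x hx)), pos (lit b x), pos_mem_arrow.2 rfl, rfl⟩

/-- A clause of the form `a₁ ∧ ⋯ ∧ aₙ → b` where `b` is not among the premises. -/
def IsRule (c : Clause) : Prop :=
  ∃ b : Var, ∀ l ∈ c, l = pos b ∨ ∃ a, a ≠ b ∧ l = neg a

theorem isHorn_of_isRule {A : CNF} (h : ∀ c ∈ A, IsRule c) : IsHorn A := by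
  intro c hc
  obtain ⟨b, hb⟩ := h c hc
  refine Finset.card_le_one_iff_subset_singleton.2 ⟨pos b, fun l hl => ?_⟩
  rw [Finset.mem_filter] at hl
  rcases hb l hl.1 with rfl | ⟨a, -, rfl⟩
  · exact Finset.mem_singleton_self _
  · exact absurd hl.2 (by simp [neg])

theorem tautologyFree_of_isRule {A : CNF} (h : ∀ c ∈ A, IsRule c) : TautologyFree A := by
  rintro c hc x ⟨ht, hf⟩
  obtain ⟨b, hb⟩ := h c hc
  rcases hb _ ht with ht | ⟨a, -, ht⟩
  · rcases hb _ hf with hf | ⟨a, hab, hf⟩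
    · simp [pos] at hf
    · simp only [pos, neg, Prod.mk.injEq, and_true] at ht hf
      exact hab (name_injective (hf.symm.trans ht))
  · simp [neg] at ht

theorem isRule_arrow {a b : Var} (h : a ≠ b) : IsRule (arrow a b).toFinset :=
  ⟨b, fun _ hl => (mem_arrow.1 hl).symm.imp_right fun e => ⟨a, h, e⟩⟩

theorem isRule_of_isFixed {F : WrittenCNF} {c : Clause} (h : IsFixed F c) : IsRule c := by
  rcases h with ⟨b, x, hx⟩ | ⟨i, f, m, hf, hm⟩ | _ | _
  · refine ⟨lit (!b) x, fun l hl => ?_⟩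
    simp only [swap, List.mem_toFinset, List.mem_cons, List.not_mem_nil, or_false] at hl
    rcases hl with rfl | rfl | rfl
    · exact .inr ⟨_, by simp, rfl⟩
    · exact .inr ⟨_, by simp, rfl⟩
    · exact .inl rfl
  · exact isRule_arrow (by simp)
  · refine ⟨goal, fun l hl => ?_⟩
    rcases mem_allClause.1 (List.mem_toFinset.1 hl) with rfl | rfl | ⟨i, hi, rfl⟩
    · exact .inl rfl
    · exact .inr ⟨_, by simp, rfl⟩
    · exact .inr ⟨_, by simp, rfl⟩
  · exact isRule_arrow (by simp)

theorem isRule_of_mem {F : WrittenCNF} {c : Clause} (h : c ∈ (reduction F).1.toCNF) :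
    IsRule c := by
  rcases mem_reduction.1 h with h | (⟨b, x, hx⟩ | ⟨b, x, hx⟩ | _ | _)
  · exact isRule_of_isFixed h
  all_goals exact isRule_arrow (by simp)

/-! ### The formula that expresses forgetting -/

/-- The clauses by which the start implies the literals that are true in an assignment. -/
def choice (F : WrittenCNF) (β : ℕ → Bool) : CNF :=
  (occurring F).image fun x => (arrow start (lit (β x) x)).toFinset

theorem mem_choice {F : WrittenCNF} {β : ℕ → Bool} {c : Clause} :
    c ∈ choice F β ↔ ∃ x ∈ occurring F, (arrow start (lit (β x) x)).toFinset = c :=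
  Finset.mem_image

theorem size_fixed_union_choice (F : WrittenCNF) (β : ℕ → Bool) :
    size (fixed F ∪ choice F β) = size (fixed F) + 2 * (occurring F).card := by
  rw [size_union, choice, size, size, Finset.sum_image,
    Finset.sum_congr rfl fun x _ => card_arrow _ _]
  · simp [mul_comm]
  · intro x _ y _ h
    exact (lit.inj (arrow_inj h).2).2
  -- The only fixed clause with the premise `start` has the conclusion `cl 0`.
  · rw [Finset.disjoint_left]
    rintro _ h h'
    obtain ⟨x, -, rfl⟩ := mem_choice.1 h'
    have hs := neg_mem_arrow (a := start) (b := lit (β x) x).2 rfl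
    have hp := pos_mem_arrow (a := start) (b := lit (β x) x).2 rfl
    generalize (arrow start (lit (β x) x)).toFinset = c at *
    rcases mem_fixed.1 h with ⟨b, x, hx⟩ | ⟨i, f, l, hf, hl⟩ | _ | _
    · exact absurd (neg_mem_swap.1 hs) (by simp)
    · exact absurd (neg_mem_arrow.1 hs) (by simp)
    · exact absurd (neg_mem_allClause.1 hs) (by simp)
    · exact absurd (pos_mem_arrow.1 hp) (by simp)

/-- An assignment that satisfies the clauses of a written formula. -/
theorem satisfiable_iff {F : WrittenCNF} :
    Satisfiable F.toCNF ↔ ∃ β : ℕ → Bool, ∀ f ∈ F, ∃ l ∈ f, β l.1 = l.2 := by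
  simp [Satisfiable, Models, WrittenCNF.toCNF]

theorem models_union {v : ℕ → Bool} {A B : CNF} :
    Models v (A ∪ B) ↔ Models v A ∧ Models v B := by
  simp only [Models, Finset.mem_union]
  exact ⟨fun h => ⟨fun c hc => h c (.inl hc), fun c hc => h c (.inr hc)⟩,
    fun h c hc => hc.elim (h.1 c) (h.2 c)⟩

theorem models_fixed {v : ℕ → Bool} {F : WrittenCNF} :
    Models v (fixed F) ↔ FixedModel F (trueVars v) := by
  simp only [Models, mem_fixed, fixedModel_iff]

theorem models_choice {v : ℕ → Bool} {F : WrittenCNF} {β : ℕ → Bool} : Models v (choice F β) ↔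
    ∀ x ∈ occurring F, trueVars v start → trueVars v (lit (β x) x) := by
  simp only [Models, choice, Finset.forall_mem_image, eval_arrow]

theorem models_congr {v v' : ℕ → Bool} {C : CNF} (h : ∀ n ∈ vars C, v n = v' n) :
    Models v C ↔ Models v' C := by
  refine forall₂_congr fun c hc => exists_congr fun l => and_congr_right fun hl => ?_
  rw [h l.1 (mem_vars.2 ⟨c, hc, l, hl, rfl⟩)]

theorem name_mem_kept {F : WrittenCNF} {a : Var} : a.name ∈ (reduction F).2.1.toFinset ↔
    a = start ∨ a = goal ∨ (∃ i ≤ F.length, a = cl i) ∨ ∃ x ∈ occurring F, ∃ b, a = lit b x := by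
  simp only [mem_kept, name_inj]

theorem vars_subset_kept {F : WrittenCNF} {β : ℕ → Bool} :
    vars (fixed F ∪ choice F β) ⊆ (reduction F).2.1.toFinset := by
  have harrow {a b : Var} (ha : a.name ∈ (reduction F).2.1.toFinset)
      (hb : b.name ∈ (reduction F).2.1.toFinset) (l : Literal) (hl : l ∈ (arrow a b).toFinset) :
      l.1 ∈ (reduction F).2.1.toFinset := by
    rcases mem_arrow.1 hl with rfl | rfl
    exacts [ha, hb]
  intro n hn
  obtain ⟨c, hc, l, hl, rfl⟩ := mem_vars.1 hn
  rcases Finset.mem_union.1 hc with hc | hc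
  · rcases mem_fixed.1 hc with ⟨b, x, hx⟩ | ⟨i, f, m, hf, hm⟩ | _ | _
    · simp only [swap, List.mem_toFinset, List.mem_cons, List.not_mem_nil, or_false] at hl
      rcases hl with rfl | rfl | rfl
      · exact name_mem_kept.2 (.inr (.inl rfl))
      · exact name_mem_kept.2 (.inr (.inr (.inr ⟨x, hx, _, rfl⟩)))
      · exact name_mem_kept.2 (.inr (.inr (.inr ⟨x, hx, _, rfl⟩)))
    · have hi := (List.getElem?_eq_some_iff.1 hf).1
      have hx : m.1 ∈ occurring F := mem_occurring.2 ⟨f, List.mem_of_getElem? hf, m.2, hm⟩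
      exact harrow (name_mem_kept.2 (.inr (.inr (.inr ⟨_, hx, _, rfl⟩))))
        (name_mem_kept.2 (.inr (.inr (.inl ⟨_, hi, rfl⟩)))) l hl
    · rcases mem_allClause.1 (List.mem_toFinset.1 hl) with rfl | rfl | ⟨i, hi, rfl⟩
      · exact name_mem_kept.2 (.inr (.inl rfl))
      · exact name_mem_kept.2 (.inr (.inr (.inl ⟨0, Nat.zero_le _, rfl⟩)))
      · exact name_mem_kept.2 (.inr (.inr (.inl ⟨_, hi, rfl⟩)))
    · exact harrow (name_mem_kept.2 (.inl rfl))
        (name_mem_kept.2 (.inr (.inr (.inl ⟨0, Nat.zero_le _, rfl⟩)))) l hl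
  · obtain ⟨x, hx, rfl⟩ := mem_choice.1 hc
    exact harrow (name_mem_kept.2 (.inl rfl))
      (name_mem_kept.2 (.inr (.inr (.inr ⟨x, hx, _, rfl⟩)))) l hl

/-- The literals implied by the start when the choice satisfies the given formula. -/
theorem lit_of_start {F : WrittenCNF} {β : ℕ → Bool} (hβ : ∀ f ∈ F, ∃ l ∈ f, β l.1 = l.2)
    {s : Var → Prop} (hs : FixedModel F s) (hc : ∀ x ∈ occurring F, s start → s (lit (β x) x))
    (h : s start) : s goal ∧ ∀ x ∈ occurring F, ∀ b, s (lit b x) := by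
  have hg : s goal := by
    refine hs.all (hs.init h) fun i hi => ?_
    obtain ⟨⟨x, b⟩, hl, e⟩ := hβ F[i] (List.getElem_mem hi)
    have hx : x ∈ occurring F := mem_occurring.2 ⟨F[i], List.getElem_mem hi, b, hl⟩
    exact hs.sat i F[i] x b (List.getElem?_eq_getElem hi) hl
      ((show β x = b from e) ▸ hc x hx h)
  refine ⟨hg, fun x hx b => ?_⟩
  have h1 := hc x hx h
  by_cases hb : b = β x
  · rwa [hb]
  · rw [show b = !β x by cases b <;> cases h : β x <;> simp_all]
    exact hs.swap x hx _ hg h1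

/-- The value of a variable in the extension of a model to the variables to forget. -/
def extend (s : Var → Prop) : Var → Prop
  | aux b x => s (lit b x)
  | goalAux => s goal
  | a => s a

/-- The point is that a model of the short formula extends to the forgotten variables. Each of these
copies the variable it implies, so only the clauses with premise `start` could fail, and
`lit_of_start` supplies their conclusions. The extension agrees with the model on the kept
variables, the only ones that `C` can see. -/
theorem expressesForgetting {F : WrittenCNF} {β : ℕ → Bool}
    (hβ : ∀ f ∈ F, ∃ l ∈ f, β l.1 = l.2) :
    ExpressesForgetting (reduction F).1.toCNF (reduction F).2.1.toFinset
      (fixed F ∪ choice F β) := by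
  refine ⟨vars_subset_kept, fun C hC => ⟨fun h v hv => h v ?_, fun h v hv => ?_⟩⟩
  · obtain ⟨hf, hb⟩ := models_reduction.1 hv
    exact models_union.2 ⟨models_fixed.2 hf,
      models_choice.2 fun x hx hs => hb.aux_lit x hx _ (hb.start_aux x hx _ hs)⟩
  · obtain ⟨hf, hc⟩ := models_union.1 hv
    rw [models_fixed] at hf
    rw [models_choice] at hc
    have hstart := lit_of_start hβ hf hc
    have hm : Models (assign (extend (trueVars v))) (reduction F).1.toCNF := by
      rw [models_reduction, trueVars_assign]
      exact ⟨⟨hf.swap, hf.sat, hf.all, hf.init⟩,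
        ⟨fun x hx b hs => (hstart hs).2 x hx b, fun _ _ _ hs => hs, fun hs => (hstart hs).1,
          fun hs => hs⟩⟩
    refine (models_congr fun n hn => ?_).1 (h _ hm)
    have key (a : Var) (ha : extend (trueVars v) a = trueVars v a) :
        assign (extend (trueVars v)) a.name = v a.name := by
      rw [Bool.eq_iff_iff, assign_name, ha]
      rfl
    rcases mem_kept.1 (hC hn) with rfl | rfl | ⟨i, -, rfl⟩ | ⟨x, -, b, rfl⟩ <;> exact key _ rfl

/-! ### The lower bound -/

section LowerBound

variable {F : WrittenCNF} {B : CNF}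

theorem entails_arrow_of_forgetting
    (hB : ExpressesForgetting (reduction F).1.toCNF (reduction F).2.1.toFinset B) {a b : Var}
    (ha : a.name ∈ (reduction F).2.1.toFinset) (hb : b.name ∈ (reduction F).2.1.toFinset)
    (h : ∀ s, FixedModel F s → BridgeModel F s → s a → s b) (v : ℕ → Bool) (hv : Models v B) :
    trueVars v a → trueVars v b := by
  refine eval_arrow.1 ((hB.2 {(arrow a b).toFinset} ?_).2 ?_ v hv _ (Finset.mem_singleton_self _))
  · intro n hn
    simp only [mem_vars, Finset.mem_singleton, exists_eq_left, mem_arrow] at hn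
    obtain ⟨l, rfl | rfl, rfl⟩ := hn
    exacts [ha, hb]
  · intro u hu c hc
    rw [Finset.mem_singleton.1 hc]
    obtain ⟨h1, h2⟩ := models_reduction.1 hu
    exact eval_arrow.2 (h _ h1 h2)

theorem entails_fixed_of_forgetting
    (hB : ExpressesForgetting (reduction F).1.toCNF (reduction F).2.1.toFinset B) :
    Entails B (fixed F) := by
  refine (hB.2 (fixed F) ?_).2 fun v hv => models_fixed.2 (models_reduction.1 hv).1
  refine subset_trans (fun n hn => ?_) (vars_subset_kept (β := fun _ => true))
  obtain ⟨c, hc, h⟩ := mem_vars.1 hn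
  exact mem_vars.2 ⟨c, Finset.mem_union_left _ hc, h⟩

/-- Every clause has a conclusion. Consequences of the formula hold here too, which excludes the
empty clause from them and provides positive literals in `exists_choice_clause`. -/
theorem models_reduction_true : Models (assign fun _ => True) (reduction F).1.toCNF := by
  rw [models_reduction, trueVars_assign]
  constructor <;> constructor <;> simp

/-- A formula that expresses forgetting has a clause from the start to a literal over `x`. -/
theorem exists_choice_clause
    (hB : ExpressesForgetting (reduction F).1.toCNF (reduction F).2.1.toFinset B) {x : ℕ}
    (hx : x ∈ occurring F) :
    ∃ d ∈ B, ∃ b, pos (lit b x) ∈ d ∧ neg start ∈ d ∧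
      (∀ b y, pos (lit b y) ∈ d → y = x) ∧ ∀ c ∈ fixed F, ¬c ⊆ d := by
  -- Only the literals over `x` and their auxiliary copies are false. This contradicts `start → lit
  -- true x` but satisfies all fixed clauses.
  set s : Var → Prop := fun
    | lit _ y => y ≠ x
    | aux _ y => y ≠ x
    | _ => True with hs
  have hAB := entails_of_forgetting hB
  have hnot : ¬Models (assign s) B := fun hm => by
    have := entails_arrow_of_forgetting hB (a := start) (b := lit true x)
      (name_mem_kept.2 (.inl rfl)) (name_mem_kept.2 (.inr (.inr (.inr ⟨x, hx, _, rfl⟩))))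
      (fun s _ h hs => h.aux_lit x hx _ (h.start_aux x hx _ hs)) _ hm
    rw [trueVars_assign] at this
    exact this trivial rfl
  simp only [Models, not_forall, not_clause_iff] at hnot
  obtain ⟨d, hd, hdf⟩ := hnot
  -- Some literal of `d` is true when all variables are and false in `s`, hence positive. Of the
  -- kept variables, only those `lit b x` are false in `s`.
  have hb : ∃ b, pos (lit b x) ∈ d := by
    obtain ⟨l, hl, e⟩ := hAB _ models_reduction_true d hd
    have hne := hdf l hl
    have hl2 : l.2 = true := by
      by_contra hn
      rw [Bool.not_eq_true] at hn
      rw [hn, ne_eq, Bool.not_eq_false] at hne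
      simp only [hn, assign, decide_eq_true_eq, decide_eq_false_iff_not] at hne e
      exact e (hne.imp fun a ha => ⟨trivial, ha.2⟩)
    obtain ⟨a, -, ha⟩ : ∃ a : Var, True ∧ a.name = l.1 := by
      simpa only [hl2, assign, decide_eq_true_eq] using e
    obtain rfl : l = pos a := Prod.ext ha.symm hl2
    have hsa : ¬s a := fun h => hne ((assign_pos s a).2 h)
    have hkept := name_mem_kept.1 (hB.1 (mem_vars.2 ⟨d, hd, _, hl, rfl⟩))
    cases a with
    | lit b y => exact ⟨b, (not_not.1 hsa : y = x) ▸ hl⟩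
    | aux b y => simp at hkept
    | _ => exact absurd trivial hsa
  obtain ⟨b, hb⟩ := hb
  refine ⟨d, hd, b, hb, ?_, fun b y hy => ?_, fun c hc hcd => ?_⟩
  -- With `start` false as well, `s` is a model of the whole formula, hence of `d`.
  · refine mem_of_models_update hdf (hAB _ (models_reduction.2 ?_) d hd)
    have : trueVars (Function.update (assign s) (neg start).1 (neg start).2) =
        fun a => a ≠ start ∧ s a := by
      funext b
      by_cases hb : b = start
      · simp [trueVars, neg, hb]
      · simp [trueVars, neg, name_inj, hb, assign_name]
    rw [this]
    exact ⟨⟨fun _ _ _ _ h => ⟨by simp, h.2⟩, fun _ _ _ _ _ _ _ => ⟨by simp, trivial⟩,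
      fun _ _ => ⟨by simp, trivial⟩, fun _ => ⟨by simp, trivial⟩⟩,
      ⟨fun _ _ _ h => absurd rfl h.1, fun _ _ _ h => ⟨by simp, h.2⟩,
      fun _ => ⟨by simp, trivial⟩, fun _ => ⟨by simp, trivial⟩⟩⟩
  · by_contra hyx
    refine hdf _ hy ((assign_pos _ _).2 ?_)
    exact hyx
  · have hm : Models (assign s) (fixed F) := by
      rw [models_fixed, trueVars_assign]
      exact ⟨fun _ _ _ _ h => h, fun _ _ _ _ _ _ _ => trivial, fun _ _ => trivial,
        fun _ => trivial⟩
    obtain ⟨l, hl, e⟩ := hm c hc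
    exact hdf l (hcd hl) e

/-- The fixed clauses are essential, but `start → lit b x` is not, because either sign may be
chosen; the clauses of `exists_choice_clause` are therefore counted separately, as the set `E`. They
differ for different `x` since each has positive literals over one `x` only. In the case of equality
`B` is `fixed F ∪ choice F b`, and a clause of `F` false under `b` gives a model of `B` with `start`
true and `goal` false. -/
theorem size_bound
    (hB : ExpressesForgetting (reduction F).1.toCNF (reduction F).2.1.toFinset B) :
    (reduction F).2.2 ≤ size B ∧ (size B ≤ (reduction F).2.2 → Satisfiable F.toCNF) := by
  have hAB := entails_of_forgetting hB
  choose! d hd b hpos hneg huniq hfix using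
    fun x (hx : x ∈ occurring F) => exists_choice_clause hB hx
  set E : CNF := (occurring F).image d with hE
  have hinj : Set.InjOn d (occurring F) := fun x hx y hy e =>
    huniq y hy (b x) x (e ▸ hpos x hx)
  have hsub (x) (hx : x ∈ occurring F) : (arrow start (lit (b x) x)).toFinset ⊆ d x := by
    intro l hl
    rcases mem_arrow.1 hl with rfl | rfl
    exacts [hneg x hx, hpos x hx]
  have hcard (x) (hx : x ∈ occurring F) : 2 ≤ (d x).card :=
    card_arrow start (lit (b x) x) ▸ Finset.card_le_card (hsub x hx)
  have hsize : size E = ∑ x ∈ occurring F, (d x).card := Finset.sum_image hinj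
  have hE2 : 2 * (occurring F).card ≤ size E := by
    rw [hsize, mul_comm, ← smul_eq_mul]
    exact Finset.card_nsmul_le_sum _ _ _ hcard
  obtain ⟨hle, heq⟩ := size_add_size_le (G := fixed F) (E := E)
    (fun c hc => isEssential_of_mem (mem_reduction.2 (.inl (mem_fixed.1 hc)))) hAB
    (entails_fixed_of_forgetting hB) (Finset.image_subset_iff.2 hd)
    (fun c hc e he => by
      obtain ⟨x, hx, rfl⟩ := Finset.mem_image.1 he
      exact hfix x hx c hc)
  rw [count_eq_size]
  refine ⟨by lia, fun hB' => ?_⟩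
  have hempty : ∅ ∉ B := fun h => by
    simpa using hAB _ models_reduction_true ∅ h
  have hBE := heq (by lia) hempty
  have hcard2 : ∀ x ∈ occurring F, 2 = (d x).card := by
    refine (Finset.sum_eq_sum_iff_of_le hcard).1 ?_
    rw [← hsize, Finset.sum_const, smul_eq_mul]
    lia
  have hEc : E = choice F b := by
    refine Finset.image_congr fun x hx => ?_
    refine (Finset.eq_of_subset_of_card_le (hsub x hx) ?_).symm
    rw [card_arrow, hcard2 x hx]
  rw [satisfiable_iff]
  by_contra! hcon
  obtain ⟨f, hf, hbf⟩ := hcon b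
  -- The closure of `start` under the clauses other than `allClause` and the swaps: the chosen
  -- literals and the satisfied clauses. As `i - 1` is truncated, the condition `i ≠ 0` is what
  -- makes `cl 0` true.
  set s : Var → Prop := fun
    | lit b' x => b' = b x
    | cl i => ∀ g, F[i - 1]? = some g → i ≠ 0 → ∃ l ∈ g, b l.1 = l.2
    | start => True
    | _ => False with hs
  have hm : Models (assign s) B := by
    rw [hBE, models_union, hEc, models_fixed, models_choice, trueVars_assign]
    refine ⟨⟨fun x _ b' h => h.elim, fun i g x b' hg hl e => ?_, fun _ h => ?_, fun _ => ?_⟩,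
      fun x _ _ => rfl⟩
    · intro g' hg' _
      obtain rfl : g = g' := Option.some.inj (hg.symm.trans hg')
      exact ⟨_, hl, e.symm⟩
    · obtain ⟨i, hi, rfl⟩ := List.mem_iff_getElem.1 hf
      obtain ⟨l, hl, e⟩ := h i hi _ (List.getElem?_eq_getElem hi) (Nat.succ_ne_zero i)
      exact hbf l hl e
    · exact fun _ _ h => absurd rfl h
  have := entails_arrow_of_forgetting hB (a := start) (b := goal)
    (name_mem_kept.2 (.inl rfl)) (name_mem_kept.2 (.inr (.inl rfl)))
    (fun s _ h hs => h.goalAux_goal (h.start_goalAux hs)) _ hm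
  rw [trueVars_assign] at this
  exact this trivial

end LowerBound

/-- The properties of the reduction other than its running time. -/
theorem reduction_correct (F : WrittenCNF) (A : CNF) (X : Finset ℕ) (k : ℕ)
    (hA : A = (reduction F).1.toCNF) (hX : X = (reduction F).2.1.toFinset)
    (hk : k = (reduction F).2.2) :
    TautologyFree A ∧ IsHorn A ∧ IsMinimal A ∧ X ⊆ vars A ∧
      (Satisfiable F.toCNF →
        (∃ B, TautologyFree B ∧ IsHorn B ∧ ExpressesForgetting A X B ∧ size B = k) ∧
          ∀ B, ExpressesForgetting A X B → k ≤ size B) ∧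
      (¬Satisfiable F.toCNF → ∀ B, ExpressesForgetting A X B → k < size B) := by
  subst hA hX hk
  refine ⟨tautologyFree_of_isRule fun _ => isRule_of_mem, isHorn_of_isRule fun _ => isRule_of_mem,
    isMinimal_reduction F, kept_subset_vars F, fun h => ⟨?_, fun B hB => (size_bound hB).1⟩,
    fun h B hB => lt_of_not_ge fun hle => h ((size_bound hB).2 hle)⟩
  obtain ⟨β, hβ⟩ := satisfiable_iff.1 h
  have hrule : ∀ c ∈ fixed F ∪ choice F β, IsRule c := fun c hc => by
    rcases Finset.mem_union.1 hc with hc | hc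
    · exact isRule_of_isFixed (mem_fixed.1 hc)
    · obtain ⟨x, -, rfl⟩ := mem_choice.1 hc
      exact isRule_arrow (by simp)
  exact ⟨_, tautologyFree_of_isRule hrule, isHorn_of_isRule hrule, expressesForgetting hβ,
    (size_fixed_union_choice F β).trans (count_eq_size F).symm⟩

end HornForget

namespace HornForget

open Computability Function Var

/-! ### Names in binary -/

/-- Binary names begin with the lowest bit and have no leading zeros; the hypothesis excludes
`Nat.bit false 0`, whose name is empty. -/
theorem encodeNat_bit (b : Bool) (n : ℕ) (h : n = 0 → b = true) :
    encodeNat (Nat.bit b n) = b :: encodeNat n := by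
  have e (m : ℕ) : encodeNat m = encodeNum (Num.ofNat' m) := by rw [encodeNat, Num.ofNat'_eq]
  rw [e, e, Num.ofNat'_bit]
  cases hm : Num.ofNat' n with
  | zero =>
    have : n = 0 := by
      have := Num.to_of_nat n
      rw [← Num.ofNat'_eq, hm] at this
      exact this.symm
    rw [h this]
    rfl
  | pos p => cases b <;> rfl

theorem encodeNat_tag (a b c : Bool) (n : ℕ) :
    encodeNat (16 * n + 8 + (4 * c.toNat + 2 * b.toNat + a.toNat)) =
      a :: b :: c :: true :: encodeNat n := by
  have h : 16 * n + 8 + (4 * c.toNat + 2 * b.toNat + a.toNat) =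
      Nat.bit a (Nat.bit b (Nat.bit c (Nat.bit true n))) := by
    cases a <;> cases b <;> cases c <;> simp [Nat.bit_val] <;> ring
  have h3 : Nat.bit true n ≠ 0 := by simp [Nat.bit_val]
  have h2 : Nat.bit c (Nat.bit true n) ≠ 0 := by rw [Nat.bit_val c]; lia
  have h1 : Nat.bit b (Nat.bit c (Nat.bit true n)) ≠ 0 := by rw [Nat.bit_val b]; lia
  rw [h, encodeNat_bit _ _ (absurd · h1), encodeNat_bit _ _ (absurd · h2),
    encodeNat_bit _ _ (absurd · h3), encodeNat_bit _ _ fun _ => rfl]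

theorem encodeNat_two_pow_sub_one (j : ℕ) : encodeNat (2 ^ j - 1) = List.replicate j true := by
  induction j with
  | zero => rfl
  | succ j ih =>
    have : 2 ^ (j + 1) - 1 = Nat.bit true (2 ^ j - 1) := by
      have : 0 < 2 ^ j := by positivity
      rw [Nat.bit_val, pow_succ]
      simp only [Bool.toNat_true]
      lia
    rw [this, encodeNat_bit _ _ fun _ => rfl, ih, List.replicate_succ]

theorem encodeNat_injective : Injective encodeNat :=
  LeftInverse.injective decode_encodeNat

theorem encodeName_lit (b : Bool) (x : ℕ) : encodeName (lit b x).name =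
    .bit b :: .bit false :: .bit false :: .bit true :: encodeName x := by
  have := encodeNat_tag b false false x
  simp only [Bool.toNat_false, mul_zero, zero_add] at this
  simp [encodeName, name, this]

theorem encodeName_aux (b : Bool) (x : ℕ) : encodeName (aux b x).name =
    .bit b :: .bit true :: .bit false :: .bit true :: encodeName x := by
  have := encodeNat_tag b true false x
  simp only [Bool.toNat_false, Bool.toNat_true, mul_zero, mul_one, zero_add, ← add_assoc] at this
  simp [encodeName, name, this]

theorem encodeName_cl (j : ℕ) : encodeName (cl j).name =
    .bit false :: .bit false :: .bit true :: .bit true :: List.replicate j (.bit true) := by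
  have := encodeNat_tag false false true (2 ^ j - 1)
  simp only [Bool.toNat_false, Bool.toNat_true, mul_zero, mul_one, add_zero, add_assoc,
    encodeNat_two_pow_sub_one] at this
  simp [encodeName, name, this]

theorem encodeName_start : encodeName start.name =
    [.bit true, .bit false, .bit true, .bit true] := by
  have := encodeNat_tag true false true 0
  exact (congrArg (List.map Sym.bit) this).trans rfl

theorem encodeName_goal : encodeName goal.name =
    [.bit false, .bit true, .bit true, .bit true] := by
  have := encodeNat_tag false true true 0
  exact (congrArg (List.map Sym.bit) this).trans rfl

theorem encodeName_goalAux : encodeName goalAux.name =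
    [.bit true, .bit true, .bit true, .bit true] := by
  have := encodeNat_tag true true true 0
  exact (congrArg (List.map Sym.bit) this).trans rfl

/-! ### Subroutines -/

namespace Prog

section

variable {K Γ R : Type} [DecidableEq K]

/-- The largest number of symbols that a program pushes in one step, or a bound on it. -/
def width : Prog K Γ R → ℕ
  | .load _ | .pop _ _ => 0
  | .push _ _ => 1
  | .transfer _ ds => ds.length
  | .seq p q | .ite _ _ p q => max p.width q.width
  | .loop _ _ p => p.width

theorem length_pushAll_le (a : Γ) (ds : List K) (S : K → List Γ) (k : K) :
    (pushAll a ds S k).length ≤ (S k).length + ds.length := by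
  induction ds generalizing S with
  | nil => simp [pushAll]
  | cons d ds ih =>
    refine (ih _).trans ?_
    by_cases h : k = d
    · subst h; simp; lia
    · simp [h]

/-- Space is bounded by time. This bounds the cost of draining the output stacks without computing
the length of the output. -/
theorem Exec.length_le {p : Prog K Γ R} {c c' : Mem K Γ R} {t : ℕ} (h : Exec p c t c') (k : K) :
    (c'.2 k).length ≤ (c.2 k).length + t * p.width := by
  induction h with
  | load => simp
  | push k' f r S =>
    by_cases h : k = k'
    · subst h; simp [width]
    · simp [h]
  | pop k' f r S =>
    by_cases h : k = k'
    · subst h; simp [width]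
    · simp [h]
  | transfer k' ds r S a L hS =>
    refine (length_pushAll_le a ds _ k).trans ?_
    by_cases h : k = k'
    · subst h; simp [width, hS]
    · simp [width, h]
  | @seq p q c₁ t₁ c₂ t₂ c₃ _ _ ih₁ ih₂ =>
    have h1 := Nat.mul_le_mul_left t₁ (le_max_left p.width q.width)
    have h2 := Nat.mul_le_mul_left t₂ (le_max_right p.width q.width)
    rw [width, add_mul]
    lia
  | @ite_true _ _ p q _ t _ _ _ ih =>
    have h1 := Nat.mul_le_mul_left t (le_max_left p.width q.width)
    rw [width, add_mul]
    lia
  | @ite_false _ _ p q _ t _ _ _ ih =>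
    have h1 := Nat.mul_le_mul_left t (le_max_right p.width q.width)
    rw [width, add_mul]
    lia
  | @loop_true _ _ p _ t₁ _ t₂ _ _ _ _ ih₁ ih₂ =>
    simp only [width, add_mul] at *
    lia
  | loop_false => simp

theorem Runs.length_le {p : Prog K Γ R} {c c' : Mem K Γ R} {n : ℕ} (h : Runs p c c' n) (k : K) :
    (c'.2 k).length ≤ (c.2 k).length + n * p.width :=
  let ⟨_, ht, e⟩ := h
  (e.length_le k).trans (Nat.add_le_add_left (Nat.mul_le_mul_right _ ht) _)

/-- Move a stack to other stacks, which reverses it. -/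
def drain (k : K) (ds : List K) : Prog K Γ R := .loop k (fun _ a => a.isSome) (.transfer k ds)

/-- A symbol costs a test and a transfer, and the final failing test costs one step. -/
theorem runs_drain (k : K) (ds : List K) (r : R) (L : List Γ) (S : K → List Γ) (hk : k ∉ ds)
    (hds : ds.Nodup) (hS : S k = L) :
    Runs (drain k ds) (r, S)
      (r, fun i => if i = k then [] else if i ∈ ds then L.reverse ++ S i else S i)
      (2 * L.length + 1) := by
  have hpush (a : Γ) (T : K → List Γ) (i : K) :
      pushAll a ds T i = if i ∈ ds then a :: T i else T i := by
    clear hk hS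
    induction ds generalizing T with
    | nil => simp [pushAll]
    | cons d ds ih =>
      rw [List.nodup_cons] at hds
      rw [pushAll, ih hds.2]
      by_cases h : i = d
      · subst h; simp [hds.1]
      · simp [h]
  induction L generalizing S with
  | nil =>
    refine Runs.of_eq (Runs.loop_false (by simp [hS])) (congrArg _ (funext fun i => ?_)) (by simp)
    by_cases h : i = k
    · subst h; simp [hS]
    · simp [h]
  | cons a L ih =>
    refine (Runs.loop_true (by simp [hS]) (Runs.transfer ds r hS)
      (ih (S := pushAll a ds (update S k L)) (by simp [hpush, hk]))).of_eq
      (congrArg _ (funext fun i => ?_)) (by simp only [List.length_cons]; lia)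
    by_cases h : i = k
    · simp [h]
    · by_cases h' : i ∈ ds <;> simp [h, h', hpush]

end

end Prog

end HornForget

namespace HornForget

open Computability Function Var Prog

/-! ### The program -/

/-- The stacks of the program. -/
inductive Stk
  | inp | name | tmp | scan | idx | out | kept | all | ticks | res
  deriving DecidableEq

instance : Fintype Stk where
  elems := {.inp, .name, .tmp, .scan, .idx, .out, .kept, .all, .ticks, .res}
  complete s := by cases s <;> decide

/-- The register of the program: the sign of the literal at hand, whether the scan is still in
its clause, whether its variable and the literal itself have been found, the sign of the scanned
literal, whether its name agrees so far, and the bit last read. -/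
structure Reg where
  sgn : Bool
  same : Bool
  hasVar : Bool
  hasLit : Bool
  lsgn : Bool
  eqv : Bool
  cur : Bool
  deriving DecidableEq

instance : Fintype Reg :=
  .ofSurjective (fun p : Bool × Bool × Bool × Bool × Bool × Bool × Bool =>
    Reg.mk p.1 p.2.1 p.2.2.1 p.2.2.2.1 p.2.2.2.2.1 p.2.2.2.2.2.1 p.2.2.2.2.2.2)
    fun ⟨a, b, c, d, e, f, g⟩ => ⟨(a, b, c, d, e, f, g), rfl⟩

instance : Inhabited Sym := ⟨.tick⟩

/-- The register at the beginning and at the end. -/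
def Reg.init : Reg := ⟨false, false, false, false, false, false, false⟩

/-- The stacks with given contents. -/
def stk (i n m q j o k a t z : List Sym) : Stk → List Sym
  | .inp => i
  | .name => n
  | .tmp => m
  | .scan => q
  | .idx => j
  | .out => o
  | .kept => k
  | .all => a
  | .ticks => t
  | .res => z

section stk

variable (i n m q j o k a t z x : List Sym)

@[simp] theorem stk_inp : stk i n m q j o k a t z .inp = i := rfl
@[simp] theorem stk_name : stk i n m q j o k a t z .name = n := rfl
@[simp] theorem stk_tmp : stk i n m q j o k a t z .tmp = m := rfl
@[simp] theorem stk_scan : stk i n m q j o k a t z .scan = q := rfl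
@[simp] theorem stk_idx : stk i n m q j o k a t z .idx = j := rfl
@[simp] theorem stk_out : stk i n m q j o k a t z .out = o := rfl
@[simp] theorem stk_kept : stk i n m q j o k a t z .kept = k := rfl
@[simp] theorem stk_all : stk i n m q j o k a t z .all = a := rfl
@[simp] theorem stk_ticks : stk i n m q j o k a t z .ticks = t := rfl
@[simp] theorem stk_res : stk i n m q j o k a t z .res = z := rfl

@[simp] theorem update_inp :
    update (stk i n m q j o k a t z) .inp x = stk x n m q j o k a t z := by
  funext s; cases s <;> simp
@[simp] theorem update_name :
    update (stk i n m q j o k a t z) .name x = stk i x m q j o k a t z := by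
  funext s; cases s <;> simp
@[simp] theorem update_tmp :
    update (stk i n m q j o k a t z) .tmp x = stk i n x q j o k a t z := by
  funext s; cases s <;> simp
@[simp] theorem update_scan :
    update (stk i n m q j o k a t z) .scan x = stk i n m x j o k a t z := by
  funext s; cases s <;> simp
@[simp] theorem update_idx :
    update (stk i n m q j o k a t z) .idx x = stk i n m q x o k a t z := by
  funext s; cases s <;> simp
@[simp] theorem update_out :
    update (stk i n m q j o k a t z) .out x = stk i n m q j x k a t z := by
  funext s; cases s <;> simp
@[simp] theorem update_kept :
    update (stk i n m q j o k a t z) .kept x = stk i n m q j o x a t z := by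
  funext s; cases s <;> simp
@[simp] theorem update_all :
    update (stk i n m q j o k a t z) .all x = stk i n m q j o k x t z := by
  funext s; cases s <;> simp
@[simp] theorem update_ticks :
    update (stk i n m q j o k a t z) .ticks x = stk i n m q j o k a x z := by
  funext s; cases s <;> simp

end stk

/-- The program that does nothing. -/
def skip : Prog Stk Sym Reg := .load id

/-- The test for a nonempty stack. -/
def isNonempty : Reg → Option Sym → Bool := fun _ a => a.isSome

/-- The test for a bit on top of a stack. -/
def isBit : Reg → Option Sym → Bool
  | _, some (.bit _) => true
  | _, _ => false

/-- The test for the beginning of a clause. -/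
def isClause : Reg → Option Sym → Bool := fun _ a => decide (a = some .clause)

/-- The sign of a literal. -/
def signOf : Option Sym → Bool
  | some (.lit b) => b
  | _ => false

/-- The value of a bit. -/
def bitOf : Option Sym → Bool
  | some (.bit b) => b
  | _ => false

/-- Read a literal: its sign to the register, its name to its stack. -/
def readLiteral : Prog Stk Sym Reg :=
  .seq (.pop .inp fun r a => { r with sgn := signOf a }) <|
  .seq (.loop .inp isBit (.transfer .inp [.tmp])) <|
  drain .tmp [.name]

/-- Compare a bit of the name of the scanned literal with one of the literal at hand. -/
def compareBit : Prog Stk Sym Reg :=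
  .seq (.pop .inp fun r a => { r with cur := bitOf a }) <|
  .seq (.push .scan fun r => .bit r.cur) <|
  .seq (.ite .name (fun r a => decide (a = some (.bit r.cur)))
    (.transfer .name [.tmp])
    (.ite .name isNonempty
      (.seq (.load fun r => { r with eqv := false }) (.transfer .name [.tmp]))
      (.load fun r => { r with eqv := false }))) <|
  .load (fun r => { r with cur := false })

/-- Compare the name of the scanned literal with that of the literal at hand, which is thereby
moved to another stack. -/
def compareBits : Prog Stk Sym Reg := .loop .inp isBit compareBit

/-- Scan a literal and record whether it agrees with the literal at hand. -/
def scanLiteral : Prog Stk Sym Reg :=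
  .seq (.pop .inp fun r a => { r with lsgn := signOf a }) <|
  .seq (.push .scan fun r => .lit r.lsgn) <|
  .seq (.load fun r => { r with eqv := true }) <|
  .seq compareBits <|
  .seq (.ite .name isNonempty (.load fun r => { r with eqv := false }) skip) <|
  .seq (drain .tmp [.name]) <|
  .load (fun r => { r with
    hasVar := r.hasVar || r.eqv
    hasLit := r.hasLit || (r.eqv && r.same && (r.lsgn == r.sgn))
    lsgn := false
    eqv := false })

/-- Scan the rest of the input. -/
def scanLoop : Prog Stk Sym Reg :=
  .loop .inp isNonempty
    (.ite .inp isClause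
      (.seq (.load fun r => { r with same := false }) (.transfer .inp [.scan]))
      scanLiteral)

/-- Scan the rest of the input for the literal at hand, and restore it. -/
def scanRest : Prog Stk Sym Reg :=
  .seq (.load fun r => { r with same := true }) <| .seq scanLoop <| drain .scan [.inp]

/-- What to emit: a symbol, or the contents of a stack. -/
inductive Item
  | sym (f : Reg → Sym)
  | name
  | idx

/-- Copy a stack to another one, which reverses it. -/
def copyTo (k d : Stk) : Prog Stk Sym Reg := .seq (drain k [.tmp, d]) (drain .tmp [k])

/-- Write to a stack, from which it is to be read in reverse. -/
def emit (d : Stk) : List Item → Prog Stk Sym Reg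
  | [] => skip
  | .sym f :: T => .seq (.push d f) (emit d T)
  | .name :: T => .seq (copyTo .name d) (emit d T)
  | .idx :: T => .seq (copyTo .idx d) (emit d T)

/-- The string that is written. -/
def denote (r : Reg) (n j : List Sym) : List Item → List Sym
  | [] => []
  | .sym f :: T => f r :: denote r n j T
  | .name :: T => n ++ denote r n j T
  | .idx :: T => j ++ denote r n j T

/-- A symbol to emit. -/
def out (s : Sym) : Item := .sym fun _ => s

/-- The name of variable `start`, to emit. -/
def startItems : List Item := [out (.bit true), out (.bit false), out (.bit true), out (.bit true)]

/-- The name of variable `goal`, to emit. -/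
def goalItems : List Item := [out (.bit false), out (.bit true), out (.bit true), out (.bit true)]

/-- The name of variable `goalAux`, to emit. -/
def goalAuxItems : List Item :=
  [out (.bit true), out (.bit true), out (.bit true), out (.bit true)]

/-- The name of a variable `lit b x`, to emit. -/
def litItems (b : Reg → Bool) : List Item :=
  [.sym fun r => .bit (b r), out (.bit false), out (.bit false), out (.bit true), .name]

/-- The name of a variable `aux b x`, to emit. -/
def auxItems (b : Bool) : List Item :=
  [out (.bit b), out (.bit true), out (.bit false), out (.bit true), .name]

/-- The name of a variable `cl j`, to emit. -/
def clItems : List Item :=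
  [out (.bit false), out (.bit false), out (.bit true), out (.bit true), .idx]

/-- A clause `a → b`, to emit. -/
def arrowItems (a b : List Item) : List Item :=
  out .clause :: out (.lit false) :: a ++ out (.lit true) :: b

/-- A clause that swaps literals, to emit. -/
def swapItems (b : Bool) : List Item :=
  out .clause :: out (.lit false) :: goalItems ++
    out (.lit false) :: litItems (fun _ => b) ++ out (.lit true) :: litItems (fun _ => !b)

/-- The clauses for an occurrence of a literal, to emit. -/
def litClausesItems : List Item :=
  swapItems false ++ swapItems true ++
  arrowItems startItems (auxItems false) ++
  arrowItems (auxItems false) (litItems fun _ => false) ++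
  arrowItems startItems (auxItems true) ++
  arrowItems (auxItems true) (litItems fun _ => true) ++
  arrowItems (litItems Reg.sgn) clItems

/-- The variables to keep for an occurrence of a literal, to emit. -/
def litKeptItems : List Item :=
  out .var :: litItems (fun _ => false) ++ out .var :: litItems (fun _ => true)

/-- Handle an occurrence of a literal. -/
def literalBody : Prog Stk Sym Reg :=
  .seq readLiteral <|
  .seq scanRest <|
  .seq (emit .out litClausesItems) <|
  .seq (emit .kept litKeptItems) <|
  .seq (.ite .inp (fun r _ => r.hasLit) skip (emit .ticks (List.replicate 2 (out .tick)))) <|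
  .seq (.ite .inp (fun r _ => r.hasVar) skip (emit .ticks (List.replicate 8 (out .tick)))) <|
  .seq (drain .name []) <|
  .load (fun _ => Reg.init)

/-- Handle the beginning of a clause. -/
def clauseBody : Prog Stk Sym Reg :=
  .seq (.transfer .inp []) <|
  .seq (.push .idx (fun _ => .bit true)) <|
  .seq (emit .kept (out .var :: clItems)) <|
  .seq (emit .all (out (.lit false) :: clItems)) <|
  .push .ticks (fun _ => .tick)

/-- Handle the input. -/
def mainLoop : Prog Stk Sym Reg :=
  .loop .inp isNonempty (.ite .inp isClause clauseBody literalBody)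

/-- Write what does not depend on the input. -/
def prologue : Prog Stk Sym Reg :=
  .seq (emit .out (arrowItems startItems clItems ++ arrowItems startItems goalAuxItems ++
    arrowItems goalAuxItems goalItems)) <|
  .seq (emit .kept (out .var :: startItems ++ out .var :: goalItems ++ out .var :: clItems)) <|
  .seq (emit .all (out .clause :: out (.lit true) :: goalItems ++ out (.lit false) :: clItems)) <|
  emit .ticks (List.replicate 4 (out .tick))

/-- Put the output together. -/
def epilogue : Prog Stk Sym Reg :=
  .seq (drain .ticks [.res]) <|
  .seq (drain .kept [.res]) <|
  .seq (drain .all [.res]) <|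
  .seq (drain .out [.res]) <|
  drain .idx []

/-- The program for the reduction. -/
def program : Prog Stk Sym Reg :=
  .seq prologue <|
  .seq mainLoop <|
  epilogue

/-! ### Correctness of the parts of the program -/

section

variable (i n m q j o k a t z : List Sym)

theorem runs_skip (r : Reg) (S : Stk → List Sym) : Runs skip (r, S) (r, S) 1 := .load ..

/-- The way through `tmp` and back reverses the source twice, so it is restored, while `d` receives
it once reversed. -/
theorem runs_copyTo (d : Stk) (r : Reg) (S : Stk → List Sym) (s : Stk) (hs : s ≠ .tmp)
    (hd : d ≠ .tmp) (hsd : s ≠ d) (ht : S .tmp = []) :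
    Runs (copyTo s d) (r, S) (r, update S d ((S s).reverse ++ S d)) (4 * (S s).length + 2) := by
  refine Runs.of_eq (.seq
    (runs_drain s [.tmp, d] r (S s) S (by simp [hs, hsd]) (by simp [hd.symm]) rfl)
    (runs_drain .tmp [s] r (S s).reverse _ (by simp [hs.symm]) (by simp)
      (by simp [hs.symm, ht]))) (congrArg _ (funext fun x => ?_))
    (by simp only [List.length_reverse]; lia)
  by_cases h1 : x = .tmp
  · subst h1; simp [hd.symm, ht]
  · by_cases h2 : x = s
    · subst h2; simp [h1, hsd]
    · by_cases h3 : x = d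
      · subst h3; simp [h1, h2]
      · simp [h1, h2, h3]

theorem runs_emit (d : Stk) (hd : d ≠ .name ∧ d ≠ .idx ∧ d ≠ .tmp) (T : List Item) (r : Reg)
    (S : Stk → List Sym) (ht : S .tmp = []) {b : ℕ} (hn : (S .name).length ≤ b)
    (hj : (S .idx).length ≤ b) :
    Runs (emit d T) (r, S) (r, update S d ((denote r (S .name) (S .idx) T).reverse ++ S d))
      (T.length * (4 * b + 2) + 1) := by
  induction T generalizing S with
  | nil => exact (runs_skip r S).of_eq (by simp [denote]) (by simp)
  | cons x T ih =>
    have key (w : List Sym) := ih (update S d (w.reverse ++ S d)) (by simpa [hd.2.2.symm])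
      (by simpa [hd.1.symm]) (by simpa [hd.2.1.symm])
    cases x with
    | sym f =>
      refine ((Runs.push d f r S).seq (key [f r])).of_eq ?_ (by simp only [List.length_cons]; lia)
      simp [denote, hd.1.symm, hd.2.1.symm]
    | name =>
      refine ((runs_copyTo d r S .name (by decide) hd.2.2 hd.1.symm ht).seq (key _)).of_eq ?_
        (by simp only [List.length_cons]; lia)
      simp [denote, hd.1.symm, hd.2.1.symm]
    | idx =>
      refine ((runs_copyTo d r S .idx (by decide) hd.2.2 hd.2.1.symm ht).seq (key _)).of_eq ?_
        (by simp only [List.length_cons]; lia)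
      simp [denote, hd.1.symm, hd.2.1.symm]

/-- The rest of the input after a name. -/
def NoBit (w : List Sym) : Prop := ∀ r, isBit r w.head? = false

/-- Names have no end mark: the loop stops at the first symbol that is not a bit, which `NoBit`
guarantees to come right after the name. -/
theorem runs_readLiteral (b s v l u e c : Bool) (s' : Bool) (x : ℕ) (hi : NoBit i) :
    Runs readLiteral
      (⟨s', s, v, l, u, e, c⟩, stk (encodeLiteral (x, b) ++ i) [] [] q j o k a t z)
      (⟨b, s, v, l, u, e, c⟩, stk i (encodeName x) [] q j o k a t z)
      (4 * (encodeName x).length + 3) := by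
  have loop (L : List Bool) (r : Reg) (m : List Sym) :
      Runs (.loop .inp isBit (.transfer .inp [.tmp]))
        (r, stk (L.map .bit ++ i) [] m q j o k a t z)
        (r, stk i [] ((L.map Sym.bit).reverse ++ m) q j o k a t z) (2 * L.length + 1) := by
    induction L generalizing m with
    | nil => exact (Runs.loop_false (hi r)).of_eq (by simp) (by simp)
    | cons b L ih =>
      have body : Runs (.transfer .inp [.tmp])
          (r, stk ((b :: L).map .bit ++ i) [] m q j o k a t z)
          (r, stk (L.map .bit ++ i) [] (.bit b :: m) q j o k a t z) 1 :=
        Runs.of_eq (.transfer (a := Sym.bit b) (L := L.map .bit ++ i) _ _ rfl)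
          (by simp [pushAll]) le_rfl
      refine Runs.of_eq (.loop_true ?_ body (ih (.bit b :: m))) (by simp) ?_
      · rfl
      · rw [List.length_cons]; lia
  have pop : Runs (.pop .inp (fun (r : Reg) a => { r with sgn := signOf a }))
      (⟨s', s, v, l, u, e, c⟩, stk (encodeLiteral (x, b) ++ i) [] [] q j o k a t z)
      (⟨b, s, v, l, u, e, c⟩, stk ((encodeNat x).map .bit ++ i) [] [] q j o k a t z) 1 :=
    (Runs.pop ..).of_eq (by simp [encodeLiteral, encodeName, signOf]) le_rfl
  refine Runs.of_eq (pop.seq ((loop _ _ _).seq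
    (runs_drain Stk.tmp [Stk.name] _ ((encodeName x).reverse) _ (by decide) (by simp)
      (by simp [encodeName])))) (congrArg _ (funext fun x => ?_))
      (by simp only [encodeName, List.length_reverse, List.length_map]; lia)
  cases x <;> simp [encodeName]

theorem runs_compareBit_nil (b g s v l u e : Bool) :
    Runs compareBit (⟨g, s, v, l, u, e, false⟩, stk (.bit b :: i) [] m q j o k a t z)
      (⟨g, s, v, l, u, false, false⟩, stk i [] m (.bit b :: q) j o k a t z) 6 :=
  (Runs.seq (.pop ..) (.seq (.push ..) (.seq (.ite_false (by simp)
    (.ite_false (by simp [isNonempty]) (.load ..))) (.load ..)))).of_eq (by simp [bitOf]) (by lia)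

theorem runs_compareBit_cons (b b' g s v l u e : Bool) :
    Runs compareBit (⟨g, s, v, l, u, e, false⟩, stk (.bit b :: i) (.bit b' :: n) m q j o k a t z)
      (⟨g, s, v, l, u, e && decide (b = b'), false⟩,
        stk i n (.bit b' :: m) (.bit b :: q) j o k a t z) 7 := by
  by_cases h : b' = b
  · subst h
    exact (Runs.seq (.pop ..) (.seq (.push ..) (.seq (.ite_true (by simp [bitOf])
      (.transfer (a := .bit b') (L := n) _ _ (by simp))) (.load ..)))).of_eq
      (by simp [bitOf, pushAll]) (by lia)
  · exact (Runs.seq (.pop ..) (.seq (.push ..) (.seq (.ite_false (by simpa [bitOf] using h)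
      (.ite_true (by simp [isNonempty]) (.seq (.load ..)
        (.transfer (a := .bit b') (L := n) _ _ (by simp))))) (.load ..)))).of_eq
      (by simp [bitOf, pushAll, Ne.symm h]) (by lia)

/-- This is a comparison of prefixes. A scanned name that is too long exhausts the name at hand and
clears the flag; one that is too short leaves the flag alone and a remainder on the stack, to be
tested afterwards. -/
theorem runs_compareBits (L N : List Bool) (g s v l u e : Bool) (hi : NoBit i) :
    Runs compareBits
      (⟨g, s, v, l, u, e, false⟩, stk (L.map .bit ++ i) (N.map .bit) m q j o k a t z)
      (⟨g, s, v, l, u, e && decide (L = N.take L.length), false⟩,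
        stk i ((N.drop L.length).map .bit) (((N.take L.length).map Sym.bit).reverse ++ m)
          ((L.map Sym.bit).reverse ++ q) j o k a t z) (8 * L.length + 1) := by
  induction L generalizing N m q e with
  | nil => exact (Runs.loop_false (hi _)).of_eq (by simp) (by simp)
  | cons b L ih =>
    cases N with
    | nil =>
      exact (Runs.loop_true rfl (runs_compareBit_nil ..) (ih m (.bit b :: q) [] false)).of_eq
        (by simp) (by simp only [List.length_cons]; lia)
    | cons b' N =>
      exact (Runs.loop_true rfl (runs_compareBit_cons ..)
        (ih (.bit b' :: m) (.bit b :: q) N (e && decide (b = b')))).of_eq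
        (by simp [Bool.and_assoc]) (by simp only [List.length_cons]; lia)

end

end HornForget

namespace HornForget

open Computability Function Var Prog

/-! ### Scanning the remaining input for repetitions -/

theorem noBit_encodeCNF (F : WrittenCNF) : NoBit (encodeCNF F) := by
  intro r
  cases F <;> simp [encodeCNF, encodeClause, isBit]

theorem noBit_literals (f : List Literal) {i : List Sym} (hi : NoBit i) :
    NoBit (f.flatMap encodeLiteral ++ i) := by
  intro r
  cases f with
  | nil => exact hi r
  | cons l f => simp [encodeLiteral, isBit]

section

variable (i q j o k a t z : List Sym)

theorem runs_scanLiteral (b s v l : Bool) (x y : ℕ) (c : Bool) (hi : NoBit i) :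
    Runs scanLiteral
      (⟨b, s, v, l, false, false, false⟩,
        stk (encodeLiteral (y, c) ++ i) (encodeName x) [] q j o k a t z)
      (⟨b, s, v || decide (x = y), l || (s && decide ((x, b) = (y, c))), false, false, false⟩,
        stk i (encodeName x) [] ((encodeLiteral (y, c)).reverse ++ q) j o k a t z)
      (8 * (encodeName y).length + 2 * (encodeName x).length + 9) := by
  set L := encodeNat y with hL
  set N := encodeNat x with hN
  have first : Runs (.pop .inp (fun (r : Reg) a => { r with lsgn := signOf a }))
      (⟨b, s, v, l, false, false, false⟩,
        stk (encodeLiteral (y, c) ++ i) (encodeName x) [] q j o k a t z)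
      (⟨b, s, v, l, c, false, false⟩,
        stk (L.map .bit ++ i) (N.map .bit) [] q j o k a t z) 1 :=
    Runs.of_eq (.pop ..) (by simp [encodeLiteral, encodeName, signOf, hL, hN]) le_rfl
  -- The prefix comparison becomes equality of names, hence of variables, once no part of the name
  -- at hand is left.
  have check : Runs (.ite .name isNonempty (.load (fun r => { r with eqv := false })) skip)
      (⟨b, s, v, l, c, true && decide (L = N.take L.length), false⟩,
        stk i ((N.drop L.length).map .bit) (((N.take L.length).map Sym.bit).reverse ++ [])
          ((L.map Sym.bit).reverse ++ .lit c :: q) j o k a t z)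
      (⟨b, s, v, l, c, decide (x = y), false⟩,
        stk i ((N.drop L.length).map .bit) (((N.take L.length).map Sym.bit).reverse ++ [])
          ((L.map Sym.bit).reverse ++ .lit c :: q) j o k a t z) 2 := by
    by_cases h : N.drop L.length = []
    · refine Runs.of_eq (.ite_false (by simp [h, isNonempty]) (runs_skip ..)) ?_ le_rfl
      have h' : N.take L.length = N := List.take_of_length_le (List.drop_eq_nil_iff.1 h)
      have : L = N ↔ x = y := by
        rw [hL, hN, encodeNat_injective.eq_iff, eq_comm]
      simp [h', this]
    · refine Runs.of_eq (.ite_true ?_ (.load ..)) ?_ le_rfl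
      · simpa [isNonempty, Option.isSome_iff_ne_none] using h
      · have : x ≠ y := by
          rintro rfl
          exact h (by simp [hL, hN])
        simp [this]
  have restore := runs_drain Stk.tmp [Stk.name] (⟨b, s, v, l, c, decide (x = y), false⟩ : Reg)
    (((N.take L.length).map Sym.bit).reverse ++ [])
    (stk i ((N.drop L.length).map .bit) (((N.take L.length).map Sym.bit).reverse ++ [])
          ((L.map Sym.bit).reverse ++ .lit c :: q) j o k a t z) (by decide) (by simp) rfl
  have hlen : (((N.take L.length).map Sym.bit).reverse ++ []).length ≤ (encodeName x).length := by
    simp [encodeName, hN]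
  have hy : (encodeName y).length = L.length := by simp [encodeName, hL]
  refine Runs.of_eq (first.seq (.seq (.push ..) (.seq (.load ..) (.seq
    (Runs.cast (runs_compareBits i [] (.lit c :: q) j o k a t z L N b s v l c true hi)
      (by simp) rfl le_rfl) (check.seq (restore.seq (.load ..))))))) ?_ ?_
  · refine Prod.ext ?_ (funext fun w => ?_)
    · by_cases hxy : x = y
      · by_cases hb : b = c
        · simp [hxy, hb]
        · simp [hxy, hb, Ne.symm hb]
      · simp [hxy]
    · cases w <;> simp [encodeLiteral, encodeName, hL, hN]
  · lia

/-- The loop does not end with the clause, so the lemma puts iterations in front of a given run of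
the rest of the loop. -/
theorem scanLoop_literals (f : List Literal) (b s v l : Bool) (x : ℕ) (hi : NoBit i)
    {c : Mem Stk Sym Reg} {n : ℕ}
    (h : Runs scanLoop
      (⟨b, s, v || decide (x ∈ f.map Prod.fst), l || (s && decide ((x, b) ∈ f)), false, false,
        false⟩, stk i (encodeName x) [] ((f.flatMap encodeLiteral).reverse ++ q) j o k a t z) c n) :
    Runs scanLoop
      (⟨b, s, v, l, false, false, false⟩,
        stk (f.flatMap encodeLiteral ++ i) (encodeName x) [] q j o k a t z) c
      (n + (f.flatMap encodeLiteral).length * (2 * (encodeName x).length + 20)) := by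
  induction f generalizing q v l n with
  | nil => simpa using h
  | cons m f ih =>
    have hm : (encodeLiteral m).length = (encodeName m.1).length + 1 := by simp [encodeLiteral]
    refine Runs.cast (.loop_true (by simp [encodeLiteral, isNonempty]) (.ite_false
      (by simp [encodeLiteral, isClause]) (runs_scanLiteral (f.flatMap encodeLiteral ++ i) q j o k
        a t z b s v l x m.1 m.2 (noBit_literals f hi)))
      (ih ((encodeLiteral m).reverse ++ q) (v || decide (x = m.1))
        (l || (s && decide ((x, b) = m))) (h.cast ?_ rfl le_rfl))) (by simp) rfl ?_
    · simp [Bool.or_assoc, Bool.and_or_distrib_left]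
    · rw [List.flatMap_cons, List.length_append, hm, add_mul]
      lia

/-- Any literal here comes after a clause mark, which has cleared `same`; so `hasLit` cannot change.
The final `same` depends on whether `F` is empty and is of no interest. -/
theorem scanLoop_cnf (F : WrittenCNF) (b s v l : Bool) (x : ℕ) :
    ∃ s', Runs scanLoop
      (⟨b, s, v, l, false, false, false⟩, stk (encodeCNF F) (encodeName x) [] q j o k a t z)
      (⟨b, s', v || decide (x ∈ F.flatten.map Prod.fst), l, false, false, false⟩,
        stk [] (encodeName x) [] ((encodeCNF F).reverse ++ q) j o k a t z)
      ((encodeCNF F).length * (2 * (encodeName x).length + 20) + 1) := by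
  induction F generalizing q s v with
  | nil => exact ⟨s, Runs.of_eq (.loop_false (by simp [encodeCNF, isNonempty]))
      (by simp [encodeCNF]) (by simp)⟩
  | cons f F ih =>
    obtain ⟨s', h⟩ := ih ((encodeClause f).reverse ++ q) false
      (v || decide (x ∈ f.map Prod.fst))
    have e : encodeCNF (f :: F) = .clause :: (f.flatMap encodeLiteral ++ encodeCNF F) := rfl
    have body : Runs (.ite .inp isClause
        (.seq (.load fun r => { r with same := false }) (.transfer .inp [.scan])) scanLiteral)
        (⟨b, s, v, l, false, false, false⟩,
          stk (encodeCNF (f :: F)) (encodeName x) [] q j o k a t z)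
        (⟨b, false, v, l, false, false, false⟩,
          stk (f.flatMap encodeLiteral ++ encodeCNF F) (encodeName x) [] (.clause :: q)
            j o k a t z) 3 :=
      Runs.of_eq (.ite_true (by simp [e, isClause]) (.seq (.load ..)
        (.transfer (a := .clause) (L := f.flatMap encodeLiteral ++ encodeCNF F) _ _ rfl)))
        (by simp [pushAll]) le_rfl
    refine ⟨s', Runs.of_eq (.loop_true (by simp [e, isNonempty]) body
      (scanLoop_literals (encodeCNF F) (.clause :: q) j o k a t z f b false v l x
        (noBit_encodeCNF F) (h.cast (by simp [encodeClause]) rfl le_rfl))) ?_ ?_⟩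
    · simp [e, encodeClause, Bool.or_assoc]
    · rw [e, List.length_cons, List.length_append, add_mul, add_mul]
      lia

theorem runs_scanRest (f : List Literal) (F : WrittenCNF) (b s : Bool) (x : ℕ) :
    ∃ s', Runs scanRest
      (⟨b, s, false, false, false, false, false⟩,
        stk (f.flatMap encodeLiteral ++ encodeCNF F) (encodeName x) [] [] j o k a t z)
      (⟨b, s', decide (x ∈ (f ++ F.flatten).map Prod.fst), decide ((x, b) ∈ f), false, false,
        false⟩,
        stk (f.flatMap encodeLiteral ++ encodeCNF F) (encodeName x) [] [] j o k a t z)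
      ((f.flatMap encodeLiteral ++ encodeCNF F).length * (2 * (encodeName x).length + 22) + 3) := by
  obtain ⟨s', h⟩ := scanLoop_cnf ((f.flatMap encodeLiteral).reverse ++ []) j o k a t z F b true
    (false || decide (x ∈ f.map Prod.fst)) (false || (true && decide ((x, b) ∈ f))) x
  refine ⟨s', Runs.of_eq (.seq (.load ..) (.seq (scanLoop_literals (encodeCNF F) [] j o k a t z f b
    true false false x (noBit_encodeCNF F) h) (runs_drain Stk.scan [Stk.inp] _
      ((f.flatMap encodeLiteral ++ encodeCNF F).reverse) _ (by decide) (by simp) (by simp))))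
    (Prod.ext ?_ (funext fun w => ?_)) ?_⟩
  · simp
  · cases w <;> simp
  · simp only [List.length_append, List.length_reverse, add_mul, mul_add]
    lia

end

end HornForget

namespace HornForget

open Computability Function Var Prog

/-! ### What is emitted -/

section denote

variable (r : Reg) (n j : List Sym)

theorem denote_append (T T' : List Item) :
    denote r n j (T ++ T') = denote r n j T ++ denote r n j T' := by
  induction T with
  | nil => rfl
  | cons x T ih => cases x <;> simp [denote, ih]

theorem denote_out (s : Sym) (T : List Item) : denote r n j (out s :: T) = s :: denote r n j T :=
  rfl

theorem denote_ticks (c : ℕ) :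
    denote r n j (List.replicate c (out .tick)) = List.replicate c .tick := by
  induction c with
  | zero => rfl
  | succ c ih => simp [List.replicate_succ, denote_out, ih]

theorem denote_start : denote r n j startItems = encodeName start.name :=
  encodeName_start.symm

theorem denote_goal : denote r n j goalItems = encodeName goal.name :=
  encodeName_goal.symm

theorem denote_goalAux : denote r n j goalAuxItems = encodeName goalAux.name :=
  encodeName_goalAux.symm

theorem denote_lit (b : Reg → Bool) (x : ℕ) :
    denote r (encodeName x) j (litItems b) = encodeName (lit (b r) x).name := by
  simp [encodeName_lit, litItems, denote, out]

theorem denote_aux (b : Bool) (x : ℕ) :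
    denote r (encodeName x) j (auxItems b) = encodeName (aux b x).name := by
  simp [encodeName_aux, auxItems, denote, out]

theorem denote_cl (c : ℕ) :
    denote r n (List.replicate c (.bit true)) clItems = encodeName (cl c).name := by
  simp [encodeName_cl, clItems, denote, out]

theorem encodeClause_arrow (a b : Var) : encodeClause (arrow a b) =
    .clause :: .lit false :: (encodeName a.name ++ .lit true :: encodeName b.name) := by
  simp [encodeClause, arrow, encodeLiteral, neg, pos]

theorem denote_arrow {T T' : List Item} {a b : Var} (h : denote r n j T = encodeName a.name)
    (h' : denote r n j T' = encodeName b.name) :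
    denote r n j (arrowItems T T') = encodeClause (arrow a b) := by
  simp [arrowItems, denote_append, denote_out, h, h', encodeClause_arrow]

theorem denote_swap (b : Bool) (x : ℕ) :
    denote r (encodeName x) j (swapItems b) = encodeClause (swap b x) := by
  simp [swapItems, denote_append, denote_out, denote_goal, denote_lit, encodeClause, swap,
    encodeLiteral, neg, pos]

theorem denote_litClauses (c x : ℕ) :
    denote r (encodeName x) (List.replicate c (.bit true)) litClausesItems =
      encodeCNF (litClauses c (x, r.sgn)) := by
  simp only [litClausesItems, denote_append, denote_swap,
    denote_arrow r _ _ (denote_start ..) (denote_aux ..),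
    denote_arrow r _ _ (denote_aux ..) (denote_lit ..),
    denote_arrow r _ _ (denote_lit ..) (denote_cl ..)]
  simp [encodeCNF, litClauses]

theorem denote_litKept (x : ℕ) : denote r (encodeName x) j litKeptItems =
    encodeVars [(lit false x).name, (lit true x).name] := by
  simp [litKeptItems, denote_append, denote_out, denote_lit, encodeVars]

end denote

theorem encodeCNF_append (F G : WrittenCNF) : encodeCNF (F ++ G) = encodeCNF F ++ encodeCNF G :=
  List.flatMap_append

theorem encodeVars_append (X Y : List ℕ) : encodeVars (X ++ Y) = encodeVars X ++ encodeVars Y :=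
  List.flatMap_append

/-! ### The main loop -/

/-- The clause number, in unary. -/
def unary (c : ℕ) : List Sym := List.replicate c (.bit true)

/-- A bound on the time to process a literal or the beginning of a clause. -/
def bodyTime (B : ℕ) : ℕ := 2 * B * B + 1000 * B + 1000

section

variable (o k a t : List Sym) {B : ℕ}

theorem runs_literalBody (l : Literal) (f : List Literal) (F : WrittenCNF) (c : ℕ) (hc : c ≤ B)
    (hB : (encodeLiteral l ++ (f.flatMap encodeLiteral ++ encodeCNF F)).length ≤ B) :
    Runs literalBody
      (Reg.init, stk (encodeLiteral l ++ (f.flatMap encodeLiteral ++ encodeCNF F)) [] [] []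
        (unary c) o k a t [])
      (Reg.init, stk (f.flatMap encodeLiteral ++ encodeCNF F) [] [] [] (unary c)
        ((encodeCNF (litClauses c l)).reverse ++ o)
        ((encodeVars [(lit false l.1).name, (lit true l.1).name]).reverse ++ k) a
        (List.replicate ((if l ∈ f then 0 else 2) +
          if l.1 ∈ (f ++ F.flatten).map Prod.fst then 0 else 8) .tick ++ t) [])
      (bodyTime B) := by
  obtain ⟨x, b⟩ := l
  rw [List.length_append] at hB
  have hx : (encodeName x).length ≤ B := by
    simp only [encodeLiteral, List.length_cons] at hB
    lia
  obtain ⟨s', hscan⟩ := runs_scanRest (unary c) o k a t [] f F b false x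
  set i := f.flatMap encodeLiteral ++ encodeCNF F with hi
  set r : Reg := ⟨b, s', decide (x ∈ (f ++ F.flatten).map Prod.fst), decide ((x, b) ∈ f), false,
    false, false⟩ with hr
  have hu : (unary c).length ≤ B := by simpa [unary]
  have hread := runs_readLiteral i [] (unary c) o k a t [] b false false false false false false
    false x (noBit_literals f (noBit_encodeCNF F))
  set o' := (encodeCNF (litClauses c (x, b))).reverse ++ o with ho'
  set k' := (encodeVars [(lit false x).name, (lit true x).name]).reverse ++ k with hk'
  -- The lists of items have lengths 99 and 12, and each item takes at most `4 * B + 2` steps.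
  have hout : Runs (emit .out litClausesItems)
      (r, stk i (encodeName x) [] [] (unary c) o k a t [])
      (r, stk i (encodeName x) [] [] (unary c) o' k a t []) (99 * (4 * B + 2) + 1) :=
    Runs.of_eq (runs_emit .out (by decide) _ r _ rfl hx hu)
      (by simp [unary, denote_litClauses, ho', hr]) le_rfl
  have hkept : Runs (emit .kept litKeptItems)
      (r, stk i (encodeName x) [] [] (unary c) o' k a t [])
      (r, stk i (encodeName x) [] [] (unary c) o' k' a t []) (12 * (4 * B + 2) + 1) :=
    Runs.of_eq (runs_emit .kept (by decide) _ r _ rfl hx hu)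
      (by simp [denote_litKept, hk']) le_rfl
  have hticks (p : Bool) (m : ℕ) (t : List Sym) (test : Reg → Option Sym → Bool)
      (ht : test r i.head? = p) :
      Runs (.ite .inp test skip (emit .ticks (List.replicate m (out .tick))))
        (r, stk i (encodeName x) [] [] (unary c) o' k' a t [])
        (r, stk i (encodeName x) [] [] (unary c) o' k' a
          (List.replicate (if p then 0 else m) .tick ++ t) []) (m * (4 * B + 2) + 2) := by
    cases p with
    | true => exact Runs.of_eq (.ite_true ht (runs_skip ..)) (by simp) (by lia)
    | false =>
      exact Runs.of_eq (.ite_false ht (runs_emit .ticks (by decide) _ r _ rfl hx hu))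
        (by simp [denote_ticks]) (by simp)
  refine Runs.of_eq (hread.seq (hscan.seq (hout.seq (hkept.seq
    ((hticks (decide ((x, b) ∈ f)) 2 t (fun r _ => r.hasLit) rfl).seq
    ((hticks (decide (x ∈ (f ++ F.flatten).map Prod.fst)) 8 _ (fun r _ => r.hasVar) rfl).seq
    ((runs_drain Stk.name [] r (encodeName x) _ (by simp) (by simp) (by simp)).seq
    (.load ..)))))))) (Prod.ext rfl (funext fun w => ?_)) ?_
  · cases w <;> simp [← List.append_assoc, add_comm]
  · have h1 := Nat.mul_le_mul (show i.length ≤ B by lia)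
      (show 2 * (encodeName x).length + 22 ≤ 2 * B + 22 by lia)
    rw [mul_add] at h1
    have h2 : B * (2 * B) = 2 * B * B := by ring
    rw [bodyTime]
    lia

theorem runs_clauseBody (i : List Sym) (c : ℕ) (hc : c + 1 ≤ B) :
    Runs clauseBody
      (Reg.init, stk (.clause :: i) [] [] [] (unary c) o k a t [])
      (Reg.init, stk i [] [] [] (unary (c + 1)) o
        ((encodeVars [(cl (c + 1)).name]).reverse ++ k)
        ((encodeLiteral (neg (cl (c + 1)))).reverse ++ a) (.tick :: t) []) (bodyTime B) := by
  have hu : (unary (c + 1)).length ≤ B := by simpa [unary]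
  refine Runs.of_eq (.seq (.transfer (a := .clause) (L := i) _ _ rfl) (.seq (.push ..) (.seq
    (runs_emit .kept (by decide) _ _ _ (by simp [pushAll]) (b := B) (by simp [pushAll])
      (by simp only [pushAll, update_inp, update_idx, stk_idx]; exact hu)) (.seq
    (runs_emit .all (by decide) _ _ _ (by simp [pushAll]) (b := B) (by simp [pushAll])
      (by simp only [pushAll, update_inp, update_kept, update_idx, stk_idx]; exact hu))
      (.push ..))))) ?_ ?_
  · have : Sym.bit true :: unary c = List.replicate (c + 1) (.bit true) := rfl
    simp [pushAll, denote_out, this, denote_cl, encodeVars, encodeLiteral, neg]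
    rfl
  · rw [bodyTime]
    simp only [clItems, List.length_cons, List.length_nil]
    lia

/-- As in `scanLoop_literals`, iterations are put in front of a run of the rest of the loop. -/
theorem mainLoop_literals (f : List Literal) (F : WrittenCNF) (c : ℕ) (hc : c ≤ B)
    (hB : (f.flatMap encodeLiteral ++ encodeCNF F).length ≤ B) {m : Mem Stk Sym Reg} {n : ℕ}
    (h : Runs mainLoop
      (Reg.init, stk (encodeCNF F) [] [] [] (unary c)
        ((encodeCNF (f.flatMap (litClauses c))).reverse ++ o)
        ((encodeVars (f.flatMap fun l => [(lit false l.1).name, (lit true l.1).name])).reverse ++ k)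
        a (List.replicate (litCount f F) .tick ++ t) []) m n) :
    Runs mainLoop
      (Reg.init, stk (f.flatMap encodeLiteral ++ encodeCNF F) [] [] [] (unary c) o k a t []) m
      (n + (f.flatMap encodeLiteral).length * (bodyTime B + 2)) := by
  induction f generalizing o k t n with
  | nil => simpa [litCount, encodeCNF, encodeVars] using h
  | cons l f ih =>
    rw [List.flatMap_cons, List.append_assoc] at hB ⊢
    refine Runs.mono (.loop_true (by simp [encodeLiteral, isNonempty]) (.ite_false
      (by simp [encodeLiteral, isClause]) (runs_literalBody o k a t l f F c hc hB))
      (ih _ _ _ (by rw [List.length_append] at hB; lia) (h.cast ?_ rfl le_rfl))) ?_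
    · simp only [List.flatMap_cons, encodeCNF_append, encodeVars_append, List.reverse_append,
        List.append_assoc, litCount]
      rw [← List.append_assoc (List.replicate _ _), List.replicate_append_replicate]
      congr 3
      rw [add_comm]
    · rw [List.length_append, add_mul]
      have : 1 ≤ (encodeLiteral l).length := by simp [encodeLiteral]
      have := Nat.mul_le_mul_right (bodyTime B + 2) this
      lia

/-- The sum in `hB` does not increase: a clause mark that raises the counter is itself consumed. One
`B` thus bounds both the counter and the remaining input at every iteration. -/
theorem runs_mainLoop (F : WrittenCNF) (c : ℕ) (hB : c + (encodeCNF F).length ≤ B) :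
    Runs mainLoop
      (Reg.init, stk (encodeCNF F) [] [] [] (unary c) o k a t [])
      (Reg.init, stk [] [] [] [] (unary (c + F.length))
        ((encodeCNF (clausesFrom c F)).reverse ++ o) ((encodeVars (keptFrom c F)).reverse ++ k)
        (((negFrom c F).flatMap encodeLiteral).reverse ++ a)
        (List.replicate (count F) .tick ++ t) [])
      ((encodeCNF F).length * (bodyTime B + 2) + 1) := by
  induction F generalizing o k a t c with
  | nil =>
    exact Runs.of_eq (.loop_false (by simp [encodeCNF, isNonempty]))
      (by simp [encodeCNF, encodeVars, clausesFrom, keptFrom, negFrom, count]) (by simp)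
  | cons f F ih =>
    have e : encodeCNF (f :: F) = .clause :: (f.flatMap encodeLiteral ++ encodeCNF F) := rfl
    rw [e] at hB ⊢
    simp only [List.length_cons, List.length_append] at hB
    refine Runs.of_eq (.loop_true (by simp [isNonempty]) (.ite_true (by simp [isClause])
      (runs_clauseBody o k a t _ c (B := B) (by lia)))
      (mainLoop_literals _ _ _ _ f F (c + 1) (B := B) (by lia)
        (by rw [List.length_append]; lia) (ih _ _ _ _ (c + 1) (by lia)))) ?_ ?_
    · have e1 (x : ℕ) (X : List ℕ) : encodeVars (x :: X) = encodeVars [x] ++ encodeVars X :=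
        encodeVars_append [x] X
      have e2 : List.replicate (count F) Sym.tick ++ (List.replicate (litCount f F) Sym.tick ++
          Sym.tick :: t) = List.replicate (count (f :: F)) Sym.tick ++ t := by
        rw [show count (f :: F) = count F + (litCount f F + 1) by rw [count]; lia]
        simp [List.replicate_add]
      rw [e2]
      simp only [clausesFrom, keptFrom, negFrom, encodeCNF_append, List.cons_append,
        List.flatMap_cons, List.reverse_append, List.append_assoc, List.length_cons]
      rw [e1 _ (f.flatMap _ ++ keptFrom (c + 1) F), encodeVars_append]
      simp only [List.reverse_append, List.append_assoc, add_assoc, add_comm F.length]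
    · simp only [List.length_cons, List.length_append, add_mul]
      lia

end

/-! ### The whole program -/

theorem runs_prologue (i : List Sym) :
    Runs prologue (Reg.init, stk i [] [] [] [] [] [] [] [] [])
      (Reg.init, stk i [] [] [] (unary 0) (encodeCNF constClauses).reverse
        (encodeVars [start.name, goal.name, (cl 0).name]).reverse
        (encodeClause [pos goal, neg (cl 0)]).reverse (List.replicate 4 .tick) []) 150 := by
  have hcl : denote Reg.init [] [] clItems = encodeName (cl 0).name := denote_cl Reg.init [] 0
  have hnil : denote Reg.init [] [] [] = [] := rfl
  refine Runs.of_eq (.seq (runs_emit .out (by decide) _ _ _ rfl (b := 0) le_rfl le_rfl) (.seq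
    (runs_emit .kept (by decide) _ _ _ rfl (b := 0) le_rfl le_rfl) (.seq
    (runs_emit .all (by decide) _ _ _ rfl (b := 0) le_rfl le_rfl)
    (runs_emit .ticks (by decide) _ _ _ rfl (b := 0) le_rfl le_rfl)))) ?_ ?_
  · simp [denote_append, denote_out, denote_goal, denote_start, hcl, hnil, unary,
      denote_arrow _ _ _ (denote_start ..) hcl,
      denote_arrow _ _ _ (denote_start ..) (denote_goalAux ..),
      denote_arrow _ _ _ (denote_goalAux ..) (denote_goal ..), constClauses, encodeCNF,
      encodeVars, encodeClause, encodeLiteral, pos, neg]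
  · decide

/-- The part that comes last in the output is drained first. The output stacks hold their strings
backwards, and the drain puts them in order. -/
theorem runs_epilogue (j o k a t : List Sym) :
    Runs epilogue (Reg.init, stk [] [] [] [] j o k a t [])
      (Reg.init, onlyStack .res (o.reverse ++ (a.reverse ++ (k.reverse ++ t.reverse))))
      (2 * (t.length + k.length + a.length + o.length + j.length) + 5) := by
  refine Runs.of_eq (.seq (runs_drain Stk.ticks [Stk.res] _ t _ (by decide) (by simp) (by simp))
    (.seq (runs_drain Stk.kept [Stk.res] _ k _ (by decide) (by simp) (by simp))
    (.seq (runs_drain Stk.all [Stk.res] _ a _ (by decide) (by simp) (by simp))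
    (.seq (runs_drain Stk.out [Stk.res] _ o _ (by decide) (by simp) (by simp))
      (runs_drain Stk.idx [] _ j _ (by decide) (by simp) (by simp)))))) ?_ (by lia)
  refine Prod.ext rfl (funext fun w => ?_)
  cases w <;> simp [onlyStack]

theorem width_emit (d : Stk) (T : List Item) : (emit d T).width ≤ 2 := by
  induction T with
  | nil => simp [emit, skip, width]
  | cons x T ih => cases x <;> simp [emit, copyTo, drain, width, ih]

/-- A bound on the time before the output is put together. -/
def mainTime (n : ℕ) : ℕ := 150 + (n * (bodyTime n + 2) + 1)

theorem runs_program (F : WrittenCNF) :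
    Runs program (Reg.init, onlyStack .inp (encodeCNF F))
      (Reg.init, onlyStack .res (encodeInstance (reduction F)))
      (mainTime (encodeCNF F).length + (10 * ((encodeCNF F).length +
        2 * mainTime (encodeCNF F).length) + 5)) := by
  have hinit : onlyStack Stk.inp (encodeCNF F) =
      stk (encodeCNF F) [] [] [] [] [] [] [] [] [] := by
    funext w
    cases w <;> simp [onlyStack]
  rw [hinit]
  have hmain := (runs_prologue (encodeCNF F)).seq (runs_mainLoop _ _ _ _ F 0
    (B := (encodeCNF F).length) (by lia))
  -- At most two symbols are pushed in a step, so each of the five stacks to drain holds at most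
  -- twice as many symbols as there were steps.
  have hlen (w : Stk) := hmain.length_le w
  have hw : (prologue.seq mainLoop).width ≤ 2 := by
    simp [prologue, mainLoop, clauseBody, literalBody, readLiteral, scanRest, scanLoop, scanLiteral,
      compareBits, compareBit, skip, drain, width, width_emit]
  have hlen' (w : Stk) := (hlen w).trans (Nat.add_le_add_left (Nat.mul_le_mul_left _ hw) _)
  have h1 := hlen' .idx
  have h2 := hlen' .out
  have h3 := hlen' .kept
  have h4 := hlen' .all
  have h5 := hlen' .ticks
  simp only [stk_idx, stk_out, stk_kept, stk_all, stk_ticks, List.length_nil, zero_add]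
    at h1 h2 h3 h4 h5
  refine Runs.of_eq ((runs_prologue (encodeCNF F)).seq ((runs_mainLoop _ _ _ _ F 0
    (B := (encodeCNF F).length) (by lia)).seq (runs_epilogue ..))) ?_ ?_
  · rw [List.replicate_append_replicate]
    simp [encodeInstance, reduction, encodeCNF_append, add_comm 4]
    simp [encodeCNF, encodeVars, allClause, encodeClause]
  · simp only [mainTime]
    lia

/-- A polynomial that bounds the time of the program. -/
noncomputable def timeBound : Polynomial ℕ := 42 * .X ^ 3 + 21000 * .X ^ 2 + 21052 * .X + 3176

theorem polyTime_reduction : PolyTime reduction :=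
  nonempty_polyTime program .inp .res Reg.init encodeCNF encodeInstance reduction timeBound
    fun F => (runs_program F).mono (by
      simp only [timeBound, mainTime, bodyTime, Polynomial.eval_add, Polynomial.eval_mul,
        Polynomial.eval_pow, Polynomial.eval_X, Polynomial.eval_ofNat]
      exact le_of_eq (by ring))

end HornForget

theorem mainTheorem3 :
    ∃ f : HornForget.WrittenCNF → HornForget.WrittenCNF × List ℕ × ℕ,
      HornForget.PolyTime f ∧
      ∀ (F : HornForget.WrittenCNF) (A : HornForget.CNF) (X_C : Finset ℕ) (k : ℕ),
        A = (f F).1.toCNF → X_C = (f F).2.1.toFinset → k = (f F).2.2 →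
          HornForget.TautologyFree A ∧
          HornForget.IsHorn A ∧
          HornForget.IsMinimal A ∧
          X_C ⊆ HornForget.vars A ∧
          (HornForget.Satisfiable F.toCNF →
            (∃ B, HornForget.TautologyFree B ∧ HornForget.IsHorn B ∧
              HornForget.ExpressesForgetting A X_C B ∧ HornForget.size B = k) ∧
            ∀ B, HornForget.ExpressesForgetting A X_C B → k ≤ HornForget.size B) ∧
          (¬ HornForget.Satisfiable F.toCNF →
            ∀ B, HornForget.ExpressesForgetting A X_C B → k < HornForget.size B) :=
  ⟨HornForget.reduction, HornForget.polyTime_reduction, HornForget.reduction_correct⟩
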